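/- Let $n,p\ge 0$ be integers and let $M$ be a nonempty compact smooth manifold without boundary of dimension $2n+1$. An \emph{almost cosymplectic structure} on $M$ is a pair $(\eta,\Omega)$ of a smooth $1$-form $\eta$ and a smooth $2$-form $\Omega$ such that $\eta\wedge\Omega^n$ is a volume form (i.e. vanishes nowhere). Let $(\eta_1,\Omega_1),\dots,(\eta_{p+1},\Omega_{p+1})$ be a \emph{cosymplectic $p$-sphere} on $M$, that is, almost cosymplectic structures on $M$ with $d\eta_i=0$ and $d\Omega_i=0$ for all $i$, such that $\bigl(\sum_i\lambda_i\eta_i,\sum_i\lambda_i\Omega_i\bigr)$ is an almost cosymplectic structure for every $\lambda=(\lambda_1,\dots,\lambda_{p+1})\in\mathbb S^p\subset\mathbb R^{p+1}$. Write $H^k(M)$ for the real de Rham cohomology of $M$ and $b_k=\dim_{\mathbb R}H^k(M)$. Then: (i) the classes $[\eta_1],\dots,[\eta_{p+1}]\in H^1(M)$ are nonzero and linearly independent, and therefore $b_1\ge p+1$; (ii) if $(n,p)\ne(0,0)$, the classes $[\Omega_1],\dots,[\Omega_{p+1}]\in H^2(M)$ are nonzero and linearly independent, and therefore $b_2\ge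 p+1$. -/

import Mathlib

open scoped Manifold ContDiff

noncomputable section

namespace CosymplecticSphere

section Forms

variable {E : Type*} [NormedAddCommGroup E] [NormedSpace ℝ E]
  {M : Type*} [TopologicalSpace M] [ChartedSpace E M]

/-- A (not necessarily smooth) real differential `k`-form on `M`. -/
abbrev RawForm (E : Type*) [NormedAddCommGroup E] [NormedSpace ℝ E]
    (M : Type*) [TopologicalSpace M] [ChartedSpace E M] (k : ℕ) : Type _ :=
  (x : M) → (TangentSpace 𝓘(ℝ, E) x) [⋀^Fin k]→L[ℝ] ℝ

/-- The pullback of a form to the model space by the inverse of a chart `e`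
(meaningful on `e.target`). -/
def inChart {k : ℕ} (α : RawForm E M k) (e : OpenPartialHomeomorph M E) (y : E) :
    E [⋀^Fin k]→L[ℝ] ℝ :=
  ContinuousAlternatingMap.compContinuousLinearMap (M := E) (α (e.symm y))
    (mfderiv 𝓘(ℝ, E) 𝓘(ℝ, E) e.symm y)

/-- The exterior derivative, computed at `x` in the preferred chart at `x`. -/
def rawD {k : ℕ} (α : RawForm E M k) : RawForm E M (k + 1) := fun x =>
  ContinuousAlternatingMap.compContinuousLinearMap (M' := E)
    (extDeriv (inChart α (chartAt E x)) (chartAt E x x))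
    (mfderiv 𝓘(ℝ, E) 𝓘(ℝ, E) (chartAt E x) x)

/-- Smooth differential `k`-forms on `M`: forms whose expression in every smooth chart is smooth. -/
def DiffForm (E : Type*) [NormedAddCommGroup E] [NormedSpace ℝ E]
    (M : Type*) [TopologicalSpace M] [ChartedSpace E M] (k : ℕ) :
    Submodule ℝ (RawForm E M k) where
  carrier := {α | ∀ e ∈ IsManifold.maximalAtlas 𝓘(ℝ, E) ∞ M,
    ContDiffOn ℝ ∞ (inChart α e) e.target}
  add_mem' := fun ha hb e he => (ha e he).add (hb e he)
  zero_mem' := fun _ _ => contDiffOn_const (c := 0)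
  smul_mem' := fun c _ ha e he => (ha e he).const_smul c

instance instAddCommGroupDiffForm (k : ℕ) : AddCommGroup (DiffForm E M k) :=
  Submodule.addCommGroup _

theorem mdifferentiableAt_chart {e : OpenPartialHomeomorph M E}
    (he : e ∈ IsManifold.maximalAtlas 𝓘(ℝ, E) ∞ M) {x : M} (hx : x ∈ e.source) :
    MDifferentiableAt 𝓘(ℝ, E) 𝓘(ℝ, E) e x :=
  ((contMDiffOn_of_mem_maximalAtlas he).contMDiffAt (e.open_source.mem_nhds hx)).mdifferentiableAt
    (by simp)

theorem mdifferentiableAt_chart_symm {e : OpenPartialHomeomorph M E}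
    (he : e ∈ IsManifold.maximalAtlas 𝓘(ℝ, E) ∞ M) {y : E} (hy : y ∈ e.target) :
    MDifferentiableAt 𝓘(ℝ, E) 𝓘(ℝ, E) e.symm y :=
  ((contMDiffOn_symm_of_mem_maximalAtlas he).contMDiffAt
    (e.open_target.mem_nhds hy)).mdifferentiableAt (by simp)

theorem fderiv_transition {e e' : OpenPartialHomeomorph M E}
    (he : e ∈ IsManifold.maximalAtlas 𝓘(ℝ, E) ∞ M)
    (he' : e' ∈ IsManifold.maximalAtlas 𝓘(ℝ, E) ∞ M)
    {y : E} (hy : y ∈ e.target) (hy' : e.symm y ∈ e'.source) (v : E) :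
    fderiv ℝ (e' ∘ e.symm) y v =
      mfderiv 𝓘(ℝ, E) 𝓘(ℝ, E) e' (e.symm y) (mfderiv 𝓘(ℝ, E) 𝓘(ℝ, E) e.symm y v) := by
  have h := mfderiv_comp y (mdifferentiableAt_chart he' hy') (mdifferentiableAt_chart_symm he hy)
  rw [mfderiv_eq_fderiv] at h
  exact DFunLike.congr_fun h v

theorem mfderiv_chart_symm_chart {e : OpenPartialHomeomorph M E}
    (he : e ∈ IsManifold.maximalAtlas 𝓘(ℝ, E) ∞ M) {x : M} (hx : x ∈ e.source)
    (v : TangentSpace 𝓘(ℝ, E) x) :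
    mfderiv 𝓘(ℝ, E) 𝓘(ℝ, E) e.symm (e x) (mfderiv 𝓘(ℝ, E) 𝓘(ℝ, E) e x v) = v := by
  have h := mfderiv_comp x
    (mdifferentiableAt_chart_symm he (e.map_source hx)) (mdifferentiableAt_chart he hx)
  have h2 : mfderiv 𝓘(ℝ, E) 𝓘(ℝ, E) (e.symm ∘ e) x = mfderiv 𝓘(ℝ, E) 𝓘(ℝ, E) (id : M → M) x := by
    apply Filter.EventuallyEq.mfderiv_eq
    filter_upwards [e.open_source.mem_nhds hx] with z hz
    simp [e.left_inv hz]
  have h3 := DFunLike.congr_fun (h.symm.trans h2) v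
  rw [mfderiv_id] at h3
  exact h3

theorem inChart_change {k : ℕ} (α : RawForm E M k) {e e' : OpenPartialHomeomorph M E}
    (he : e ∈ IsManifold.maximalAtlas 𝓘(ℝ, E) ∞ M)
    (he' : e' ∈ IsManifold.maximalAtlas 𝓘(ℝ, E) ∞ M)
    {y : E} (hy : y ∈ e.target) (hy' : e.symm y ∈ e'.source) :
    inChart α e y = (inChart α e' ((e' ∘ e.symm) y)).compContinuousLinearMap
      (fderiv ℝ (e' ∘ e.symm) y) := by
  have hx : e'.symm (e' (e.symm y)) = e.symm y := e'.left_inv hy'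
  have hα : ∀ x x' : M, x = x' →
      (α x : E [⋀^Fin k]→L[ℝ] ℝ) = (α x' : E [⋀^Fin k]→L[ℝ] ℝ) := by
    rintro x _ rfl
    rfl
  have key : ∀ w : E, (mfderiv 𝓘(ℝ, E) 𝓘(ℝ, E) e'.symm (e' (e.symm y))
      (fderiv ℝ (e' ∘ e.symm) y w) : E) = mfderiv 𝓘(ℝ, E) 𝓘(ℝ, E) e.symm y w := by
    intro w
    rw [fderiv_transition he he' hy hy']
    exact mfderiv_chart_symm_chart he' hy' _
  ext v
  refine (congrArg (fun f : E [⋀^Fin k]→L[ℝ] ℝ =>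
    f fun i => mfderiv 𝓘(ℝ, E) 𝓘(ℝ, E) e.symm y (v i)) (hα _ _ hx.symm)).trans ?_
  exact congrArg (α (e'.symm (e' (e.symm y))) : E [⋀^Fin k]→L[ℝ] ℝ)
    (funext fun i => (key (v i)).symm)

theorem contDiffAt_transition {e e' : OpenPartialHomeomorph M E}
    (he : e ∈ IsManifold.maximalAtlas 𝓘(ℝ, E) ∞ M)
    (he' : e' ∈ IsManifold.maximalAtlas 𝓘(ℝ, E) ∞ M)
    {y : E} (hy : y ∈ e.target) (hy' : e.symm y ∈ e'.source) :
    ContDiffAt ℝ ∞ (e' ∘ e.symm) y :=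
  (((contMDiffOn_of_mem_maximalAtlas he').contMDiffAt (e'.open_source.mem_nhds hy')).comp y
    ((contMDiffOn_symm_of_mem_maximalAtlas he).contMDiffAt
      (e.open_target.mem_nhds hy))).contDiffAt

/-- In every smooth chart, `rawD` is the exterior derivative of the model space. -/
theorem inChart_rawD [IsManifold 𝓘(ℝ, E) ∞ M] {k : ℕ} {α : RawForm E M k}
    (hα : α ∈ DiffForm E M k) {e : OpenPartialHomeomorph M E}
    (he : e ∈ IsManifold.maximalAtlas 𝓘(ℝ, E) ∞ M) {y : E} (hy : y ∈ e.target) :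
    inChart (rawD α) e y = extDeriv (inChart α e) y := by
  set e' := chartAt E (e.symm y) with he'_def
  have he' : e' ∈ IsManifold.maximalAtlas 𝓘(ℝ, E) ∞ M := IsManifold.chart_mem_maximalAtlas _
  have hy' : e.symm y ∈ e'.source := mem_chart_source E _
  have hev : inChart α e =ᶠ[nhds y] fun z => (inChart α e' ((e' ∘ e.symm) z)).compContinuousLinearMap
      (fderiv ℝ (e' ∘ e.symm) z) := by
    filter_upwards [e.open_target.mem_nhds hy,
      (e.continuousAt_symm hy).preimage_mem_nhds (e'.open_source.mem_nhds hy')] with z hz hz'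
    exact inChart_change α he he' hz hz'
  rw [hev.extDeriv_eq, extDeriv_pullback (r := ∞) _ (contDiffAt_transition he he' hy hy')
    (by simpa using WithTop.coe_le_coe.2 (le_top (a := (2 : ℕ∞))))]
  · ext v
    exact congrArg (extDeriv (inChart α e') (e' (e.symm y)))
      (funext fun i => (fderiv_transition he he' hy hy' (v i)).symm)
  · exact ((hα e' he').contDiffAt
      (e'.open_target.mem_nhds (e'.map_source hy'))).differentiableAt (by simp)

theorem rawD_mem [IsManifold 𝓘(ℝ, E) ∞ M] {k : ℕ} {α : RawForm E M k}
    (hα : α ∈ DiffForm E M k) : rawD α ∈ DiffForm E M (k + 1) := by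
  intro e he
  have h : ContDiffOn ℝ ∞ (extDeriv (inChart α e)) e.target :=
    (ContinuousAlternatingMap.alternatizeUncurryFinCLM ℝ E ℝ).contDiff.comp_contDiffOn
      ((hα e he).fderiv_of_isOpen e.open_target (by simp))
  exact h.congr fun y hy => inChart_rawD hα he hy

theorem differentiableAt_inChart [IsManifold 𝓘(ℝ, E) ∞ M] {k : ℕ} {α : RawForm E M k}
    (hα : α ∈ DiffForm E M k) (x : M) :
    DifferentiableAt ℝ (inChart α (chartAt E x)) (chartAt E x x) :=
  ((hα _ (IsManifold.chart_mem_maximalAtlas x)).contDiffAt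
    ((chartAt E x).open_target.mem_nhds (mem_chart_target E x))).differentiableAt (by simp)

/-- The exterior derivative on smooth forms. -/
def d (E : Type*) [NormedAddCommGroup E] [NormedSpace ℝ E]
    (M : Type*) [TopologicalSpace M] [ChartedSpace E M] [IsManifold 𝓘(ℝ, E) ∞ M] (k : ℕ) :
    DiffForm E M k →ₗ[ℝ] DiffForm E M (k + 1) where
  toFun α := ⟨rawD α.1, rawD_mem α.2⟩
  map_add' α β := by
    ext x v
    have h := extDeriv_add (differentiableAt_inChart α.2 x) (differentiableAt_inChart β.2 x)
    exact congrArg (fun f : E [⋀^Fin (k + 1)]→L[ℝ] ℝ =>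
      f fun i => mfderiv 𝓘(ℝ, E) 𝓘(ℝ, E) (chartAt E x) x (v i)) h
  map_smul' c α := by
    ext x v
    have h := extDeriv_smul (x := chartAt E x x) c (inChart α.1 (chartAt E x))
    exact congrArg (fun f : E [⋀^Fin (k + 1)]→L[ℝ] ℝ =>
      f fun i => mfderiv 𝓘(ℝ, E) 𝓘(ℝ, E) (chartAt E x) x (v i)) h

section Cohomology

variable (E : Type*) [NormedAddCommGroup E] [NormedSpace ℝ E]
  (M : Type*) [TopologicalSpace M] [ChartedSpace E M] [IsManifold 𝓘(ℝ, E) ∞ M]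

/-- The closed smooth `k`-forms. -/
def closedForms (k : ℕ) : Submodule ℝ (DiffForm E M k) := LinearMap.ker (d E M k)

/-- The exact smooth `k`-forms; only `0` is exact in degree `0`. -/
def exactForms : (k : ℕ) → Submodule ℝ (DiffForm E M k)
  | 0 => ⊥
  | k + 1 => LinearMap.range (d E M k)

/-- The real de Rham cohomology `H^k(M)`, closed forms modulo exact forms. -/
abbrev DeRham (k : ℕ) : Type _ :=
  closedForms E M k ⧸ (exactForms E M k).submoduleOf (closedForms E M k)

/-- The Betti number `b_k`, the dimension of `H^k(M)`. -/
def betti (k : ℕ) : Cardinal := Module.rank ℝ (DeRham E M k)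

end Cohomology

/-- The cohomology class of a closed form. -/
def deRhamClass [IsManifold 𝓘(ℝ, E) ∞ M] {k : ℕ} (α : DiffForm E M k)
    (hα : α ∈ closedForms E M k) : DeRham E M k :=
  Submodule.Quotient.mk ⟨α, hα⟩

end Forms

section Wedge

variable {V : Type*} [AddCommGroup V] [Module ℝ V]

/-- The wedge product of real-valued alternating maps (sum over shuffles). -/
def wedge {k l : ℕ} (a : V [⋀^Fin k]→ₗ[ℝ] ℝ) (b : V [⋀^Fin l]→ₗ[ℝ] ℝ) :
    V [⋀^Fin (k + l)]→ₗ[ℝ] ℝ :=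
  ((LinearMap.mul' ℝ ℝ).compAlternatingMap (a.domCoprod b)).domDomCongr finSumFinEquiv

/-- The exterior power `b ∧ ⋯ ∧ b` (`n` factors) of an alternating 2-form. -/
def wedgePow (b : V [⋀^Fin 2]→ₗ[ℝ] ℝ) : (n : ℕ) → V [⋀^Fin (2 * n)]→ₗ[ℝ] ℝ
  | 0 => AlternatingMap.constOfIsEmpty ℝ V (Fin 0) 1
  | n + 1 => wedge (wedgePow b n) b

end Wedge

section Cosymplectic

variable {n : ℕ} {M : Type*} [TopologicalSpace M]
  [ChartedSpace (EuclideanSpace ℝ (Fin (2 * n + 1))) M]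

/-- `(η, Ω)` is an almost cosymplectic structure on the `(2n+1)`-manifold `M`:
the top degree form `η ∧ Ω^n` vanishes nowhere. -/
def IsAlmostCosymplectic (η : DiffForm (EuclideanSpace ℝ (Fin (2 * n + 1))) M 1)
    (Ω : DiffForm (EuclideanSpace ℝ (Fin (2 * n + 1))) M 2) : Prop :=
  ∀ x : M, wedge (η.1 x).toAlternatingMap (wedgePow (Ω.1 x).toAlternatingMap n) ≠ 0

/-- The pairs `(η i, Ω i)` generate an almost cosymplectic `p`-sphere. -/
structure IsAlmostCosymplecticSphere {p : ℕ}
    (η : Fin (p + 1) → DiffForm (EuclideanSpace ℝ (Fin (2 * n + 1))) M 1)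
    (Ω : Fin (p + 1) → DiffForm (EuclideanSpace ℝ (Fin (2 * n + 1))) M 2) : Prop where
  generators : ∀ i, IsAlmostCosymplectic (η i) (Ω i)
  sphere : ∀ c ∈ Metric.sphere (0 : EuclideanSpace ℝ (Fin (p + 1))) 1,
    IsAlmostCosymplectic (∑ i, c i • η i) (∑ i, c i • Ω i)

/-- The pairs `(η i, Ω i)` generate a cosymplectic `p`-sphere: they generate an almost cosymplectic
`p`-sphere and all the forms are closed. -/
structure IsCosymplecticSphere [IsManifold (𝓡 (2 * n + 1)) ∞ M] {p : ℕ}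
    (η : Fin (p + 1) → DiffForm (EuclideanSpace ℝ (Fin (2 * n + 1))) M 1)
    (Ω : Fin (p + 1) → DiffForm (EuclideanSpace ℝ (Fin (2 * n + 1))) M 2) : Prop extends
    IsAlmostCosymplecticSphere η Ω where
  closed_eta : ∀ i, η i ∈ closedForms (EuclideanSpace ℝ (Fin (2 * n + 1))) M 1
  closed_omega : ∀ i, Ω i ∈ closedForms (EuclideanSpace ℝ (Fin (2 * n + 1))) M 2

end Cosymplectic

end CosymplecticSphere

end

/-! A nontrivial linear relation among the classes can be rescaled to coefficients c on the unit
sphere. The combined form ∑ cᵢηᵢ or ∑ cᵢΩᵢ is then exact, while the combined pair (η, Ω) is still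
almost cosymplectic (`linearIndependent_deRhamClass`).

For (i), if η = df, then f attains a maximum on the compact M and η vanishes there, whereas η ∧ Ωⁿ ≠
0 forces η ≠ 0 everywhere (`exists_d_zeroForm_apply_eq_zero`).

For (ii) with n > 0, if Ω = dα, closedness of η and Ω gives d(η ∧ Ωⁿ⁻¹ ∧ α) = -η ∧ Ωⁿ, an exact
volume form, which Stokes' theorem excludes (`exists_d_apply_eq_zero`). If n = 0, each ηᵢ(x) lies in
a line, so p > 0 would produce a point of the sphere where the combination vanishes at x; thus p > 0
forces n > 0 (`dim_pos`).

Two tools carry the argument. The Leibniz rule with closed left factor (`extDeriv_wedgeC_of_closed`)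
comes from writing wedge products as alternatizations of tensor products. Stokes' theorem comes from
a partition of unity, with the supposedly nowhere vanishing exact form itself orienting M. -/

noncomputable section

namespace CosymplecticSphere

/-! ### Wedge products as alternatizations, and the algebra of the Leibniz rule. -/

section AlternatingAlgebra

variable {V : Type*} [AddCommGroup V] [Module ℝ V]

theorem alternatization_domDomCongr_equiv {ι κ : Type*} [Fintype ι] [DecidableEq ι] [Fintype κ]
    [DecidableEq κ] (e : ι ≃ κ) (f : MultilinearMap ℝ (fun _ : ι => V) ℝ) :
    MultilinearMap.alternatization (f.domDomCongr e) =
      (MultilinearMap.alternatization f).domDomCongr e := by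
  ext v
  simp only [MultilinearMap.alternatization_apply, AlternatingMap.domDomCongr_apply,
    MultilinearMap.domDomCongr_apply]
  refine (Fintype.sum_equiv (e.permCongr) _ _ fun σ => ?_).symm
  simp [Equiv.Perm.sign_permCongr]

theorem alternatization_domDomCongr_perm {ι : Type*} [Fintype ι] [DecidableEq ι]
    (σ : Equiv.Perm ι) (f : MultilinearMap ℝ (fun _ : ι => V) ℝ) :
    MultilinearMap.alternatization (f.domDomCongr σ) =
      Equiv.Perm.sign σ • MultilinearMap.alternatization f := by
  rw [alternatization_domDomCongr_equiv, AlternatingMap.domDomCongr_perm]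

/-- The tensor product of two real multilinear forms, with concatenated arguments. -/
def tensorForm {k l : ℕ} (a : MultilinearMap ℝ (fun _ : Fin k => V) ℝ)
    (b : MultilinearMap ℝ (fun _ : Fin l => V) ℝ) :
    MultilinearMap ℝ (fun _ : Fin (k + l) => V) ℝ :=
  ((LinearMap.mul' ℝ ℝ).compMultilinearMap (a.domCoprod b)).domDomCongr finSumFinEquiv

theorem tensorForm_apply {k l : ℕ} (a : MultilinearMap ℝ (fun _ : Fin k => V) ℝ)
    (b : MultilinearMap ℝ (fun _ : Fin l => V) ℝ) (v : Fin (k + l) → V) :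
    tensorForm a b v =
      a (fun i => v (Fin.castAdd l i)) * b (fun j => v (Fin.natAdd k j)) := by
  simp [tensorForm]

theorem wedge_alternatization {k l : ℕ} (a : MultilinearMap ℝ (fun _ : Fin k => V) ℝ)
    (b : MultilinearMap ℝ (fun _ : Fin l => V) ℝ) :
    wedge (MultilinearMap.alternatization a) (MultilinearMap.alternatization b) =
      MultilinearMap.alternatization (tensorForm a b) := by
  rw [tensorForm, alternatization_domDomCongr_equiv, LinearMap.compMultilinearMap_alternatization,
    MultilinearMap.domCoprod_alternization]
  rfl

/-- The wedge product as a bilinear map. -/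
def wedgeLin (k l : ℕ) : (V [⋀^Fin k]→ₗ[ℝ] ℝ) →ₗ[ℝ] (V [⋀^Fin l]→ₗ[ℝ] ℝ) →ₗ[ℝ]
    (V [⋀^Fin (k + l)]→ₗ[ℝ] ℝ) :=
  LinearMap.mk₂ ℝ wedge
    (fun a a' b => by
      ext v
      simp only [wedge, ← AlternatingMap.domCoprod'_apply, TensorProduct.add_tmul, map_add]
      simp)
    (fun c a b => by
      ext v
      simp only [wedge, ← AlternatingMap.domCoprod'_apply, ← TensorProduct.smul_tmul', map_smul]
      simp)
    (fun a b b' => by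
      ext v
      simp only [wedge, ← AlternatingMap.domCoprod'_apply, TensorProduct.tmul_add, map_add]
      simp)
    (fun c a b => by
      ext v
      simp only [wedge, ← AlternatingMap.domCoprod'_apply, TensorProduct.tmul_smul, map_smul]
      simp)

theorem wedgeLin_apply {k l : ℕ} (a : V [⋀^Fin k]→ₗ[ℝ] ℝ) (b : V [⋀^Fin l]→ₗ[ℝ] ℝ) :
    wedgeLin k l a b = wedge a b := rfl

/-- Alternatizing an already alternating k-form multiplies it by k!. This trades the sum over
shuffles for a sum over all permutations, which is easier to reindex. -/
theorem factorial_smul_wedge {k l : ℕ} (a : V [⋀^Fin k]→ₗ[ℝ] ℝ) (b : V [⋀^Fin l]→ₗ[ℝ] ℝ) :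
    ((k.factorial * l.factorial : ℕ) : ℝ) • wedge a b =
      MultilinearMap.alternatization (tensorForm a.toMultilinearMap b.toMultilinearMap) := by
  have h := wedge_alternatization a.toMultilinearMap b.toMultilinearMap
  have ha := a.coe_alternatization
  have hb := b.coe_alternatization
  rw [← h, ← wedgeLin_apply, ← wedgeLin_apply]
  erw [ha, hb]
  simp only [Fintype.card_fin, ← Nat.cast_smul_eq_nsmul ℝ, map_smul, LinearMap.smul_apply,
    smul_smul, Nat.cast_mul]
  rw [mul_comm]

/-- Uncurrying in the zeroth argument, as a multilinear form. -/
def uncurryZero {m : ℕ} (c : V →ₗ[ℝ] MultilinearMap ℝ (fun _ : Fin m => V) ℝ) :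
    MultilinearMap ℝ (fun _ : Fin (m + 1) => V) ℝ :=
  LinearMap.uncurryLeft (M := fun _ => V) c

theorem uncurryZero_domDomCongr_apply {m : ℕ}
    (c : V →ₗ[ℝ] MultilinearMap ℝ (fun _ : Fin m => V) ℝ) (σ : Equiv.Perm (Fin (m + 1)))
    {p : Fin (m + 1)} {q : Fin m → Fin (m + 1)} (h0 : σ 0 = p) (hs : ∀ i, σ i.succ = q i)
    (v : Fin (m + 1) → V) :
    (uncurryZero c).domDomCongr σ v = c (v p) (fun i => v (q i)) := by
  obtain rfl : q = fun i => σ i.succ := funext fun i => (hs i).symm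
  subst h0
  rfl

/-- `alternatizeUncurryFin A` is a signed sum of m + 1 permuted copies of the uncurried form, all
with the same alternatization. Being alternating, it is also multiplied by (m + 1)! under
alternatization; cancel m + 1. -/
theorem alternatization_uncurryZero {m : ℕ} (A : V →ₗ[ℝ] V [⋀^Fin m]→ₗ[ℝ] ℝ) :
    MultilinearMap.alternatization (uncurryZero (AlternatingMap.toMultilinearMapLM (R := ℝ) ∘ₗ A)) =
      (m.factorial : ℝ) • AlternatingMap.alternatizeUncurryFin A := by
  set U := uncurryZero (AlternatingMap.toMultilinearMapLM (R := ℝ) ∘ₗ A) with hU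
  have h1 : (AlternatingMap.alternatizeUncurryFin A).toMultilinearMap =
      ∑ p : Fin (m + 1), (Equiv.Perm.sign p.cycleRange) • U.domDomCongr p.cycleRange.symm := by
    ext v
    have := AlternatingMap.alternatizeUncurryFin_apply A v
    refine this.trans ?_
    simp only [sum_apply, smul_apply]
    refine Finset.sum_congr rfl fun p _ => ?_
    rw [hU, uncurryZero_domDomCongr_apply _ _ (Fin.cycleRange_symm_zero p)
      (Fin.cycleRange_symm_succ p)]
    simp [Units.smul_def]
    rfl
  have h2 := (AlternatingMap.alternatizeUncurryFin A).coe_alternatization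
  have h3 := congrArg MultilinearMap.alternatization h1
  rw [map_sum] at h3
  have h4 : ∀ p : Fin (m + 1), MultilinearMap.alternatization
      ((Equiv.Perm.sign p.cycleRange) • U.domDomCongr p.cycleRange.symm) =
      MultilinearMap.alternatization U := by
    intro p
    rw [Units.smul_def, map_zsmul, alternatization_domDomCongr_perm, Equiv.Perm.sign_symm,
      ← Units.smul_def, smul_smul, Int.units_mul_self, one_smul]
  simp only [h4, Finset.sum_const, Finset.card_univ, Fintype.card_fin] at h3
  have h5 := h2.symm.trans h3
  simp only [Fintype.card_fin, ← Nat.cast_smul_eq_nsmul ℝ, Nat.factorial_succ, Nat.cast_mul,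
    mul_smul] at h5
  exact (smul_right_injective _ (by positivity : ((m + 1 : ℕ) : ℝ) ≠ 0) h5).symm

/-- Expanding each `A x` over permutations of the last m slots gives m! signed copies of
`uncurryZero c`, permuted with slot 0 fixed. They share one alternatization, and m! cancels. -/
theorem alternatizeUncurryFin_alternatization {m : ℕ}
    (c : V →ₗ[ℝ] MultilinearMap ℝ (fun _ : Fin m => V) ℝ) (A : V →ₗ[ℝ] V [⋀^Fin m]→ₗ[ℝ] ℝ)
    (hA : ∀ x, A x = MultilinearMap.alternatization (c x)) :
    AlternatingMap.alternatizeUncurryFin A = MultilinearMap.alternatization (uncurryZero c) := by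
  have h := alternatization_uncurryZero A
  have h1 : uncurryZero (AlternatingMap.toMultilinearMapLM (R := ℝ) ∘ₗ A) =
      ∑ σ : Equiv.Perm (Fin m), Equiv.Perm.sign σ •
        (uncurryZero c).domDomCongr (Equiv.Perm.decomposeFin.symm (0, σ)) := by
    ext v
    simp only [sum_apply, smul_apply]
    refine (congrArg (fun f : V [⋀^Fin m]→ₗ[ℝ] ℝ => f fun i => v i.succ) (hA (v 0))).trans ?_
    refine (MultilinearMap.alternatization_apply _ _).trans ?_
    refine Finset.sum_congr rfl fun σ _ => ?_
    rw [uncurryZero_domDomCongr_apply _ _ (Equiv.Perm.decomposeFin_symm_apply_zero 0 σ)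
      (q := fun i => (σ i).succ) (by simp)]
    rfl
  have h4 : ∀ σ : Equiv.Perm (Fin m), MultilinearMap.alternatization
      (Equiv.Perm.sign σ • (uncurryZero c).domDomCongr (Equiv.Perm.decomposeFin.symm (0, σ))) =
      MultilinearMap.alternatization (uncurryZero c) := by
    intro σ
    rw [Units.smul_def, map_zsmul, alternatization_domDomCongr_perm,
      ← Units.smul_def, smul_smul]
    simp
  rw [h1, map_sum] at h
  simp only [h4, Finset.sum_const, Finset.card_univ, Fintype.card_perm, Fintype.card_fin,
    ← Nat.cast_smul_eq_nsmul ℝ] at h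
  exact (smul_right_injective _ (by positivity : (m.factorial : ℝ) ≠ 0) h).symm

/-- This is the term (da) ∧ b of the Leibniz rule. The derivative slot already stands in front of
the slots of a, so the uncurried tensor is U ⊗ b, and its alternatization contains the factor Alt U
= 0. -/
theorem alternatizeUncurryFin_eq_zero_of_wedge_right {k l : ℕ} (A : V →ₗ[ℝ] V [⋀^Fin k]→ₗ[ℝ] ℝ)
    (hA : AlternatingMap.alternatizeUncurryFin A = 0) (b : V [⋀^Fin l]→ₗ[ℝ] ℝ) :
    AlternatingMap.alternatizeUncurryFin ((wedgeLin k l).flip b ∘ₗ A) = 0 := by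
  let c : V →ₗ[ℝ] MultilinearMap ℝ (fun _ : Fin (k + l) => V) ℝ :=
    { toFun x := tensorForm (A x).toMultilinearMap b.toMultilinearMap
      map_add' x y := by
        ext v
        simp [tensorForm_apply, add_mul]
      map_smul' r x := by
        ext v
        simp [tensorForm_apply, mul_assoc] }
  set U := uncurryZero (AlternatingMap.toMultilinearMapLM (R := ℝ) ∘ₗ A) with hU
  have hUA : MultilinearMap.alternatization U = 0 := by
    rw [hU, alternatization_uncurryZero, hA, smul_zero]
  have h1 := alternatizeUncurryFin_alternatization c
    (((k.factorial * l.factorial : ℕ) : ℝ) • ((wedgeLin k l).flip b ∘ₗ A))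
    fun x => factorial_smul_wedge (A x) b
  have h2 : uncurryZero c = (tensorForm U b.toMultilinearMap).domDomCongr
      (finCongr (by omega : k + 1 + l = k + l + 1)) := by
    ext v
    rw [MultilinearMap.domDomCongr_apply, tensorForm_apply]
    refine (tensorForm_apply _ _ _).trans (congrArg₂ (· * ·) rfl (congrArg b ?_))
    funext j
    refine congrArg v (Fin.ext ?_)
    simp
    omega
  rw [h2, alternatization_domDomCongr_equiv, ← wedge_alternatization, hUA, ← wedgeLin_apply,
    map_zero, LinearMap.zero_apply, AlternatingMap.alternatizeUncurryFin_smul] at h1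
  refine (smul_eq_zero.1 (h1.trans ?_)).resolve_left (by positivity)
  rfl

/-- This is the term a ∧ db of the Leibniz rule. The sign is that of the cycle carrying the
derivative slot across the k arguments of a. -/
theorem alternatizeUncurryFin_wedge_left {k l : ℕ} (a : V [⋀^Fin k]→ₗ[ℝ] ℝ)
    (B : V →ₗ[ℝ] V [⋀^Fin l]→ₗ[ℝ] ℝ) :
    AlternatingMap.alternatizeUncurryFin (wedgeLin k l a ∘ₗ B) =
      (-1 : ℝ) ^ k • wedge a (AlternatingMap.alternatizeUncurryFin B) := by
  let c : V →ₗ[ℝ] MultilinearMap ℝ (fun _ : Fin (k + l) => V) ℝ :=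
    { toFun x := tensorForm a.toMultilinearMap (B x).toMultilinearMap
      map_add' x y := by
        ext v
        simp [tensorForm_apply, mul_add]
      map_smul' r x := by
        ext v
        simp [tensorForm_apply, mul_left_comm] }
  set U := uncurryZero (AlternatingMap.toMultilinearMapLM (R := ℝ) ∘ₗ B) with hU
  have hUB : MultilinearMap.alternatization U =
      (l.factorial : ℝ) • AlternatingMap.alternatizeUncurryFin B := alternatization_uncurryZero B
  have hUa : MultilinearMap.alternatization a.toMultilinearMap = (k.factorial : ℝ) • a := by
    have := a.coe_alternatization
    rwa [Fintype.card_fin, ← Nat.cast_smul_eq_nsmul ℝ] at this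
  have h1 := alternatizeUncurryFin_alternatization c
    (((k.factorial * l.factorial : ℕ) : ℝ) • (wedgeLin k l a ∘ₗ B))
    fun x => factorial_smul_wedge a (B x)
  -- This cycle sends position k to 0, shifts positions below k up by one, and fixes the rest.
  let σ : Equiv.Perm (Fin (k + (l + 1))) := Fin.cycleRange (Fin.natAdd k 0)
  have h2 : uncurryZero c = (tensorForm a.toMultilinearMap U).domDomCongr σ := by
    ext v
    rw [MultilinearMap.domDomCongr_apply, tensorForm_apply]
    have e1 : ∀ i : Fin k, σ (Fin.castAdd (l + 1) i) = (Fin.castAdd l i).succ := by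
      intro i
      ext
      rw [Fin.coe_cycleRange_of_lt (by simp [Fin.lt_def])]
      simp
    have e2 : σ (Fin.natAdd k 0) = (0 : Fin (k + l + 1)) := Fin.cycleRange_self _
    have e3 : ∀ j : Fin l, σ (Fin.natAdd k j.succ) = (Fin.natAdd k j).succ := by
      intro j
      rw [show σ (Fin.natAdd k j.succ) = Fin.natAdd k j.succ from
        Fin.cycleRange_of_gt (by simp [Fin.lt_def])]
      ext
      simp [add_assoc]
    have e4 : (fun i => v (σ (Fin.castAdd (l + 1) i))) = fun i => v (Fin.castAdd l i).succ :=
      funext fun i => congrArg v (e1 i)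
    have e5 : U (fun j => v (σ (Fin.natAdd k j))) = B (v 0) fun j => v (Fin.natAdd k j).succ := by
      change B (v (σ (Fin.natAdd k 0))) (fun j => v (σ (Fin.natAdd k j.succ))) = _
      have e6 : (fun j : Fin l => v (σ (Fin.natAdd k j.succ))) = fun j => v (Fin.natAdd k j).succ :=
        funext fun j => congrArg v (e3 j)
      have e7 : v (σ (Fin.natAdd k 0)) = v 0 := congrArg v e2
      exact congrArg₂ (fun x w => B x w) e7 e6
    refine Eq.trans ?_ (congrArg₂ (· * ·) (congrArg a e4.symm) e5.symm)
    exact tensorForm_apply _ _ _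
  have hσ : Equiv.Perm.sign σ = (-1) ^ k := by
    rw [Fin.sign_cycleRange]
    simp
  have h4 : MultilinearMap.alternatization (tensorForm a.toMultilinearMap U) =
      ((k.factorial * l.factorial : ℕ) : ℝ) •
        wedge a (AlternatingMap.alternatizeUncurryFin B) := by
    rw [← wedge_alternatization, hUa, hUB, ← wedgeLin_apply, map_smul, map_smul,
      LinearMap.smul_apply, smul_smul, wedgeLin_apply, Nat.cast_mul, mul_comm]
  have h3 : ((k.factorial * l.factorial : ℕ) : ℝ) •
      AlternatingMap.alternatizeUncurryFin (wedgeLin k l a ∘ₗ B) =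
      ((k.factorial * l.factorial : ℕ) : ℝ) •
        ((-1 : ℝ) ^ k • wedge a (AlternatingMap.alternatizeUncurryFin B)) := by
    rw [← AlternatingMap.alternatizeUncurryFin_smul]
    refine (h1.trans (congrArg _ h2)).trans ((alternatization_domDomCongr_perm _ _).trans ?_)
    rw [h4, hσ, Units.smul_def, ← Int.cast_smul_eq_zsmul ℝ]
    push_cast
    exact smul_comm _ _ _
  exact smul_right_injective _ (by positivity : ((k.factorial * l.factorial : ℕ) : ℝ) ≠ 0) h3

end AlternatingAlgebra

/-! ### The continuous wedge product and its exterior derivative on the model space. -/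

section ContinuousWedge

variable {E : Type*} [NormedAddCommGroup E] [NormedSpace ℝ E]

theorem wedge_apply_eq_sum {V : Type*} [AddCommGroup V] [Module ℝ V] {k l : ℕ}
    (a : V [⋀^Fin k]→ₗ[ℝ] ℝ) (b : V [⋀^Fin l]→ₗ[ℝ] ℝ) (v : Fin (k + l) → V) :
    wedge a b v = ((k.factorial * l.factorial : ℕ) : ℝ)⁻¹ *
      ∑ σ : Equiv.Perm (Fin (k + l)), Equiv.Perm.sign σ •
        (a (fun i => v (σ (Fin.castAdd l i))) * b (fun j => v (σ (Fin.natAdd k j)))) := by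
  have h := congrArg (fun f : V [⋀^Fin (k + l)]→ₗ[ℝ] ℝ => f v) (factorial_smul_wedge a b)
  simp only [AlternatingMap.smul_apply, smul_eq_mul, MultilinearMap.alternatization_apply,
    MultilinearMap.domDomCongr_apply, tensorForm_apply] at h
  rw [eq_inv_mul_iff_mul_eq₀ (by positivity)]
  exact h

/-- The wedge product of continuous alternating forms. -/
def wedgeC {k l : ℕ} (a : E [⋀^Fin k]→L[ℝ] ℝ) (b : E [⋀^Fin l]→L[ℝ] ℝ) :
    E [⋀^Fin (k + l)]→L[ℝ] ℝ :=
  { wedge a.toAlternatingMap b.toAlternatingMap with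
    cont := by
      change Continuous fun v => wedge a.toAlternatingMap b.toAlternatingMap v
      simp only [wedge_apply_eq_sum]
      refine continuous_const.mul (continuous_finsetSum _ fun σ _ => ?_)
      refine Continuous.const_smul (Continuous.mul ?_ ?_) _
      · exact a.cont.comp (continuous_pi fun i => continuous_apply _)
      · exact b.cont.comp (continuous_pi fun i => continuous_apply _) }

theorem wedgeC_compContinuousLinearMap {F : Type*} [NormedAddCommGroup F] [NormedSpace ℝ F]
    {k l : ℕ} (a : E [⋀^Fin k]→L[ℝ] ℝ) (b : E [⋀^Fin l]→L[ℝ] ℝ) (f : F →L[ℝ] E) :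
    (wedgeC a b).compContinuousLinearMap f =
      wedgeC (a.compContinuousLinearMap f) (b.compContinuousLinearMap f) := by
  ext v
  refine (wedge_apply_eq_sum _ _ _).trans (Eq.trans ?_ (wedge_apply_eq_sum _ _ _).symm)
  rfl

theorem wedgeC_add_left {k l : ℕ} (a a' : E [⋀^Fin k]→L[ℝ] ℝ) (b : E [⋀^Fin l]→L[ℝ] ℝ) :
    wedgeC (a + a') b = wedgeC a b + wedgeC a' b := by
  ext v
  exact congrArg (fun f : E [⋀^Fin (k + l)]→ₗ[ℝ] ℝ => f v)
    (LinearMap.map_add₂ (wedgeLin k l) a.toAlternatingMap a'.toAlternatingMap b.toAlternatingMap)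

theorem wedgeC_smul_left {k l : ℕ} (c : ℝ) (a : E [⋀^Fin k]→L[ℝ] ℝ) (b : E [⋀^Fin l]→L[ℝ] ℝ) :
    wedgeC (c • a) b = c • wedgeC a b := by
  ext v
  exact congrArg (fun f : E [⋀^Fin (k + l)]→ₗ[ℝ] ℝ => f v)
    (LinearMap.map_smul₂ (wedgeLin k l) c a.toAlternatingMap b.toAlternatingMap)

theorem wedgeC_add_right {k l : ℕ} (a : E [⋀^Fin k]→L[ℝ] ℝ) (b b' : E [⋀^Fin l]→L[ℝ] ℝ) :
    wedgeC a (b + b') = wedgeC a b + wedgeC a b' := by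
  ext v
  exact congrArg (fun f : E [⋀^Fin (k + l)]→ₗ[ℝ] ℝ => f v)
    (map_add (wedgeLin k l a.toAlternatingMap) b.toAlternatingMap b'.toAlternatingMap)

theorem wedgeC_smul_right {k l : ℕ} (c : ℝ) (a : E [⋀^Fin k]→L[ℝ] ℝ) (b : E [⋀^Fin l]→L[ℝ] ℝ) :
    wedgeC a (c • b) = c • wedgeC a b := by
  ext v
  exact congrArg (fun f : E [⋀^Fin (k + l)]→ₗ[ℝ] ℝ => f v)
    (map_smul (wedgeLin k l a.toAlternatingMap) c b.toAlternatingMap)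

variable [FiniteDimensional ℝ E]

/-- With finite-dimensional spaces of forms, the wedge is automatically a continuous bilinear map,
so the product rule applies without norm estimates. -/
instance finiteDimensional_continuousAlternatingMap (k : ℕ) :
    FiniteDimensional ℝ (E [⋀^Fin k]→L[ℝ] ℝ) :=
  FiniteDimensional.of_injective
    ({ toFun a := a.toContinuousMultilinearMap.toMultilinearMap
       map_add' _ _ := rfl
       map_smul' _ _ := rfl } :
      (E [⋀^Fin k]→L[ℝ] ℝ) →ₗ[ℝ] MultilinearMap ℝ (fun _ : Fin k => E) ℝ)
    fun a b h => by
      ext v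
      exact congrArg (fun f : MultilinearMap ℝ (fun _ : Fin k => E) ℝ => f v) h

/-- The wedge product with a fixed left factor as a continuous linear map. -/
def wedgeCLMLeft {k : ℕ} (l : ℕ) (a : E [⋀^Fin k]→L[ℝ] ℝ) :
    (E [⋀^Fin l]→L[ℝ] ℝ) →L[ℝ] (E [⋀^Fin (k + l)]→L[ℝ] ℝ) where
  toFun b := wedgeC a b
  map_add' := wedgeC_add_right a
  map_smul' c b := wedgeC_smul_right c a b
  cont := LinearMap.continuous_of_finiteDimensional
    { toFun b := wedgeC a b
      map_add' := wedgeC_add_right a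
      map_smul' c b := wedgeC_smul_right c a b }

theorem wedgeCLMLeft_apply {k l : ℕ} (a : E [⋀^Fin k]→L[ℝ] ℝ) (b : E [⋀^Fin l]→L[ℝ] ℝ) :
    wedgeCLMLeft l a b = wedgeC a b := rfl

/-- The wedge product as a bilinear map with values in continuous linear maps. -/
def wedgeCLMLin (k l : ℕ) : (E [⋀^Fin k]→L[ℝ] ℝ) →ₗ[ℝ] (E [⋀^Fin l]→L[ℝ] ℝ) →L[ℝ]
    (E [⋀^Fin (k + l)]→L[ℝ] ℝ) where
  toFun := wedgeCLMLeft l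
  map_add' a a' := by
    refine ContinuousLinearMap.ext fun b => ?_
    rw [add_apply, wedgeCLMLeft_apply, wedgeCLMLeft_apply,
      wedgeCLMLeft_apply, wedgeC_add_left]
  map_smul' c a := by
    refine ContinuousLinearMap.ext fun b => ?_
    rw [smul_apply, wedgeCLMLeft_apply, wedgeCLMLeft_apply,
      wedgeC_smul_left, RingHom.id_apply]

/-- The wedge product as a continuous bilinear map. -/
def wedgeCLM (k l : ℕ) : (E [⋀^Fin k]→L[ℝ] ℝ) →L[ℝ] (E [⋀^Fin l]→L[ℝ] ℝ) →L[ℝ]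
    (E [⋀^Fin (k + l)]→L[ℝ] ℝ) :=
  { wedgeCLMLin k l with
    cont := by
      refine continuous_clm_apply.2 fun b => ?_
      exact LinearMap.continuous_of_finiteDimensional
        { toFun a := wedgeC a b
          map_add' a a' := wedgeC_add_left a a' b
          map_smul' c a := wedgeC_smul_left c a b } }

theorem contDiffOn_wedgeC {k l : ℕ} {a : E → E [⋀^Fin k]→L[ℝ] ℝ} {b : E → E [⋀^Fin l]→L[ℝ] ℝ}
    {s : Set E} (ha : ContDiffOn ℝ ∞ a s) (hb : ContDiffOn ℝ ∞ b s) :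
    ContDiffOn ℝ ∞ (fun y => wedgeC (a y) (b y)) s := by
  have h : IsBoundedBilinearMap ℝ
      (fun p : (E [⋀^Fin k]→L[ℝ] ℝ) × (E [⋀^Fin l]→L[ℝ] ℝ) => wedgeC p.1 p.2) :=
    (wedgeCLM (E := E) k l).isBoundedBilinearMap
  have h2 := h.contDiff.comp_contDiffOn (ha.prodMk hb)
  exact h2

/-- The product rule splits the derivative into a ∧ Db and Da ∧ b. The second alternates to zero
because da = 0; the first contributes the sign. -/
theorem extDeriv_wedgeC_of_closed {k l : ℕ} {a : E → E [⋀^Fin k]→L[ℝ] ℝ}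
    {b : E → E [⋀^Fin l]→L[ℝ] ℝ} {x : E} (ha : DifferentiableAt ℝ a x)
    (hb : DifferentiableAt ℝ b x) (hda : extDeriv a x = 0) :
    extDeriv (fun y => wedgeC (a y) (b y)) x = (-1 : ℝ) ^ k • wedgeC (a x) (extDeriv b x) := by
  have hfd := ((wedgeCLM k l).hasFDerivAt_of_bilinear ha.hasFDerivAt hb.hasFDerivAt).fderiv
  set A := ContinuousAlternatingMap.toAlternatingMapLinear (R := ℝ) ∘ₗ (fderiv ℝ a x).toLinearMap
    with hA
  set B := ContinuousAlternatingMap.toAlternatingMapLinear (R := ℝ) ∘ₗ (fderiv ℝ b x).toLinearMap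
    with hB
  have hdA : AlternatingMap.alternatizeUncurryFin A = 0 := by
    ext v
    have := congrArg (fun f : E [⋀^Fin (k + 1)]→L[ℝ] ℝ => f v) hda
    simp only [extDeriv, ContinuousAlternatingMap.alternatizeUncurryFin_apply] at this
    rw [AlternatingMap.alternatizeUncurryFin_apply]
    exact this
  have hdB : AlternatingMap.alternatizeUncurryFin B = (extDeriv b x).toAlternatingMap := by
    ext v
    rw [AlternatingMap.alternatizeUncurryFin_apply]
    exact (ContinuousAlternatingMap.alternatizeUncurryFin_apply _ _).symm
  have h2 := alternatizeUncurryFin_eq_zero_of_wedge_right A hdA (b x).toAlternatingMap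
  have h3 := alternatizeUncurryFin_wedge_left (a x).toAlternatingMap B
  ext v
  rw [extDeriv, ContinuousAlternatingMap.alternatizeUncurryFin_apply]
  have h4 : ∀ w u, fderiv ℝ (fun y => wedgeC (a y) (b y)) x w u =
      (wedgeLin k l (a x).toAlternatingMap ∘ₗ B) w u +
      ((wedgeLin k l).flip (b x).toAlternatingMap ∘ₗ A) w u := fun w u =>
    congrArg (fun f : E →L[ℝ] E [⋀^Fin (k + l)]→L[ℝ] ℝ => f w u) hfd
  simp only [h4, smul_add, Finset.sum_add_distrib, ← AlternatingMap.alternatizeUncurryFin_apply]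
  rw [h2, h3, hdB, AlternatingMap.zero_apply, add_zero]
  rfl

end ContinuousWedge

/-! ### Wedge products and powers of smooth forms on the manifold. -/

section ManifoldWedge

variable {E : Type*} [NormedAddCommGroup E] [NormedSpace ℝ E]
  {M : Type*} [TopologicalSpace M] [ChartedSpace E M]

theorem apply_eq_inChart {k : ℕ} (α : RawForm E M k) {e : OpenPartialHomeomorph M E}
    (he : e ∈ IsManifold.maximalAtlas 𝓘(ℝ, E) ∞ M) {x : M} (hx : x ∈ e.source)
    (v : Fin k → TangentSpace 𝓘(ℝ, E) x) :
    α x v = inChart α e (e x) (fun i => mfderiv 𝓘(ℝ, E) 𝓘(ℝ, E) e x (v i)) := by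
  have hα : ∀ x x' : M, x = x' →
      (α x : E [⋀^Fin k]→L[ℝ] ℝ) = (α x' : E [⋀^Fin k]→L[ℝ] ℝ) := by
    rintro x _ rfl
    rfl
  have h1 : inChart α e (e x) (fun i => mfderiv 𝓘(ℝ, E) 𝓘(ℝ, E) e x (v i)) =
      (α (e.symm (e x)) : E [⋀^Fin k]→L[ℝ] ℝ) (fun i => mfderiv 𝓘(ℝ, E) 𝓘(ℝ, E) e.symm (e x)
        (mfderiv 𝓘(ℝ, E) 𝓘(ℝ, E) e x (v i))) := rfl
  rw [h1, hα _ _ (e.left_inv hx)]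
  exact congrArg (α x) (funext fun i => (mfderiv_chart_symm_chart he hx (v i)).symm)

theorem rawForm_ext [IsManifold 𝓘(ℝ, E) ∞ M] {k : ℕ} {α β : RawForm E M k}
    (h : ∀ x : M, inChart α (chartAt E x) (chartAt E x x) =
      inChart β (chartAt E x) (chartAt E x x)) : α = β := by
  funext x
  ext v
  have he : chartAt E x ∈ IsManifold.maximalAtlas 𝓘(ℝ, E) ∞ M :=
    IsManifold.chart_mem_maximalAtlas x
  rw [apply_eq_inChart α he (mem_chart_source E x), apply_eq_inChart β he (mem_chart_source E x),
    h x]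

theorem inChart_smul {k : ℕ} (c : ℝ) (α : RawForm E M k) (e : OpenPartialHomeomorph M E) (y : E) :
    inChart (c • α) e y = c • inChart α e y := rfl

/-- The pointwise wedge product of two forms. -/
def rawWedge {k l : ℕ} (α : RawForm E M k) (β : RawForm E M l) : RawForm E M (k + l) := fun x =>
  wedgeC (E := E) (α x) (β x)

theorem inChart_rawWedge {k l : ℕ} (α : RawForm E M k) (β : RawForm E M l)
    (e : OpenPartialHomeomorph M E) (y : E) :
    inChart (rawWedge α β) e y = wedgeC (inChart α e y) (inChart β e y) :=
  wedgeC_compContinuousLinearMap (E := E) (F := E) _ _ _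

theorem extDeriv_inChart_eq_zero [IsManifold 𝓘(ℝ, E) ∞ M] {k : ℕ} {α : DiffForm E M k}
    (hα : d E M k α = 0) {e : OpenPartialHomeomorph M E}
    (he : e ∈ IsManifold.maximalAtlas 𝓘(ℝ, E) ∞ M) {y : E} (hy : y ∈ e.target) :
    extDeriv (inChart α.1 e) y = 0 := by
  rw [← inChart_rawD α.2 he hy, show rawD α.1 = 0 from congrArg Subtype.val hα]
  rfl

/-- The constant function `1`, as a `0`-form. -/
def unitForm : DiffForm E M 0 :=
  ⟨fun _ => ContinuousAlternatingMap.constOfIsEmpty ℝ E (Fin 0) 1, fun e _ => by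
    have : inChart (fun _ => ContinuousAlternatingMap.constOfIsEmpty ℝ E (Fin 0) 1 :
        RawForm E M 0) e = fun _ => ContinuousAlternatingMap.constOfIsEmpty ℝ E (Fin 0) 1 := by
      funext y
      rfl
    rw [this]
    exact contDiffOn_const⟩

theorem d_unitForm [IsManifold 𝓘(ℝ, E) ∞ M] : d E M 0 unitForm = 0 := by
  apply Subtype.ext
  apply rawForm_ext
  intro x
  refine (inChart_rawD unitForm.2 (IsManifold.chart_mem_maximalAtlas x)
    (mem_chart_target E x)).trans ?_
  have : inChart (unitForm (E := E) (M := M)).1 (chartAt E x) =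
      fun _ => ContinuousAlternatingMap.constOfIsEmpty ℝ E (Fin 0) 1 := rfl
  rw [this, extDeriv_constOfIsEmpty]
  ext v
  simp
  rfl

variable [FiniteDimensional ℝ E]

/-- The wedge product of smooth forms. -/
def wedgeForm {k l : ℕ} (α : DiffForm E M k) (β : DiffForm E M l) : DiffForm E M (k + l) :=
  ⟨rawWedge α.1 β.1, fun e he => by
    have h : ContDiffOn ℝ ∞ (fun y => wedgeC (inChart α.1 e y) (inChart β.1 e y)) e.target :=
      contDiffOn_wedgeC (α.2 e he) (β.2 e he)
    exact h.congr fun y _ => inChart_rawWedge α.1 β.1 e y⟩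

theorem wedgeForm_apply {k l : ℕ} (α : DiffForm E M k) (β : DiffForm E M l) (x : M) :
    ((wedgeForm α β).1 x).toAlternatingMap =
      wedge (α.1 x).toAlternatingMap (β.1 x).toAlternatingMap := rfl

theorem d_wedgeForm_of_closed [IsManifold 𝓘(ℝ, E) ∞ M] {k l : ℕ} {α : DiffForm E M k}
    (hα : d E M k α = 0) (β : DiffForm E M l) :
    d E M (k + l) (wedgeForm α β) = (-1 : ℝ) ^ k • wedgeForm α (d E M l β) := by
  apply Subtype.ext
  apply rawForm_ext
  intro x
  have he : chartAt E x ∈ IsManifold.maximalAtlas 𝓘(ℝ, E) ∞ M :=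
    IsManifold.chart_mem_maximalAtlas x
  have hx := mem_chart_target E x
  have h1 : inChart (d E M (k + l) (wedgeForm α β)).1 (chartAt E x) (chartAt E x x) =
      extDeriv (inChart (wedgeForm α β).1 (chartAt E x)) (chartAt E x x) :=
    inChart_rawD (wedgeForm α β).2 he hx
  have h2 : inChart (wedgeForm α β).1 (chartAt E x) = fun y =>
      wedgeC (inChart α.1 (chartAt E x) y) (inChart β.1 (chartAt E x) y) :=
    funext fun y => inChart_rawWedge α.1 β.1 _ y
  rw [h1, h2, extDeriv_wedgeC_of_closed (differentiableAt_inChart α.2 x)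
    (differentiableAt_inChart β.2 x) (extDeriv_inChart_eq_zero hα he hx), ← inChart_rawD β.2 he hx]
  refine Eq.trans (congrArg _ ?_) (inChart_smul ((-1 : ℝ) ^ k) _ _ _).symm
  exact (inChart_rawWedge α.1 (d E M l β).1 _ _).symm

/-- The exterior powers of a smooth `2`-form. -/
def powForm (Ω : DiffForm E M 2) : (m : ℕ) → DiffForm E M (2 * m)
  | 0 => unitForm
  | m + 1 => wedgeForm (powForm Ω m) Ω

theorem powForm_apply (Ω : DiffForm E M 2) (m : ℕ) (x : M) :
    ((powForm Ω m).1 x).toAlternatingMap = wedgePow (Ω.1 x).toAlternatingMap m := by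
  induction m with
  | zero => rfl
  | succ m ih =>
    refine (wedgeForm_apply (powForm Ω m) Ω x).trans ?_
    rw [ih]
    rfl

theorem d_powForm [IsManifold 𝓘(ℝ, E) ∞ M] {Ω : DiffForm E M 2} (hΩ : d E M 2 Ω = 0) (m : ℕ) :
    d E M (2 * m) (powForm Ω m) = 0 := by
  induction m with
  | zero => exact d_unitForm
  | succ m ih =>
    refine (d_wedgeForm_of_closed ih Ω).trans ?_
    rw [hΩ]
    apply Subtype.ext
    funext x
    have : wedgeC (E := E) ((powForm Ω m).1 x) (0 : E [⋀^Fin 3]→L[ℝ] ℝ) = 0 :=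
      map_zero (wedgeCLM (E := E) (2 * m) 3 ((powForm Ω m).1 x))
    change (-1 : ℝ) ^ (2 * m) • wedgeC (E := E) ((powForm Ω m).1 x) (0 : E [⋀^Fin 3]→L[ℝ] ℝ) =
      (0 : E [⋀^Fin (2 * m + 3)]→L[ℝ] ℝ)
    rw [this, smul_zero]

end ManifoldWedge

/-! ### Multiplying forms by functions, and locality of d. -/

section FunctionMultiples

variable {E : Type*} [NormedAddCommGroup E] [NormedSpace ℝ E]
  {M : Type*} [TopologicalSpace M] [ChartedSpace E M]

theorem contDiffOn_comp_chart_symm {f : M → ℝ} (hf : ContMDiff 𝓘(ℝ, E) 𝓘(ℝ, ℝ) ∞ f)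
    {e : OpenPartialHomeomorph M E} (he : e ∈ IsManifold.maximalAtlas 𝓘(ℝ, E) ∞ M) :
    ContDiffOn ℝ ∞ (fun y => f (e.symm y)) e.target :=
  (hf.comp_contMDiffOn (contMDiffOn_symm_of_mem_maximalAtlas he)).contDiffOn

/-- The product of a smooth function and a smooth form. -/
def smulForm {k : ℕ} (f : M → ℝ) (hf : ContMDiff 𝓘(ℝ, E) 𝓘(ℝ, ℝ) ∞ f) (α : DiffForm E M k) :
    DiffForm E M k :=
  ⟨fun x => f x • α.1 x, fun e he => by
    have h : ContDiffOn ℝ ∞ (fun y => f (e.symm y) • inChart α.1 e y) e.target :=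
      (contDiffOn_comp_chart_symm hf he).smul (α.2 e he)
    exact h⟩

theorem smulForm_apply {k : ℕ} {f : M → ℝ} (hf : ContMDiff 𝓘(ℝ, E) 𝓘(ℝ, ℝ) ∞ f)
    (α : DiffForm E M k) (x : M) : (smulForm f hf α).1 x = f x • α.1 x := rfl

theorem inChart_eq_zero {k : ℕ} {α : RawForm E M k} {e : OpenPartialHomeomorph M E} {y : E}
    (h : α (e.symm y) = 0) : inChart α e y = 0 := by
  ext v
  change (α (e.symm y) : E [⋀^Fin k]→L[ℝ] ℝ) _ = 0
  rw [h]
  rfl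

theorem rawD_eq_zero_of_eventually {k : ℕ} {α : RawForm E M k} {x : M}
    (h : ∀ᶠ z in nhds x, α z = 0) : rawD α x = 0 := by
  have hev : inChart α (chartAt E x) =ᶠ[nhds (chartAt E x x)] fun _ => 0 := by
    have hc := (chartAt E x).continuousAt_symm (mem_chart_target E x)
    rw [ContinuousAt, (chartAt E x).left_inv (mem_chart_source E x)] at hc
    filter_upwards [hc.eventually h] with y hy using inChart_eq_zero hy
  have h0 : extDeriv (inChart α (chartAt E x)) (chartAt E x x) = 0 := by
    rw [hev.extDeriv_eq, extDeriv]
    ext v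
    simp [ContinuousAlternatingMap.alternatizeUncurryFin_apply]
  ext v
  exact congrArg (fun f : E [⋀^Fin (k + 1)]→L[ℝ] ℝ =>
    f fun i => mfderiv 𝓘(ℝ, E) 𝓘(ℝ, E) (chartAt E x) x (v i)) h0

theorem inChart_ne_zero {k : ℕ} {α : RawForm E M k} {e : OpenPartialHomeomorph M E}
    (he : e ∈ IsManifold.maximalAtlas 𝓘(ℝ, E) ∞ M) {y : E} (hy : y ∈ e.target)
    (h : α (e.symm y) ≠ 0) : inChart α e y ≠ 0 := by
  intro h0
  apply h
  ext v
  rw [apply_eq_inChart α he (e.map_target hy), e.right_inv hy, h0]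
  rfl

end FunctionMultiples

/-! ### Stokes' theorem for compactly supported forms on the model space. -/

section EuclideanStokes

open MeasureTheory

variable {E : Type*} [NormedAddCommGroup E] [NormedSpace ℝ E] [FiniteDimensional ℝ E]
  [MeasurableSpace E] [BorelSpace E] (ν : Measure E) [ν.IsAddHaarMeasure]

theorem integral_fderiv_apply_eq_zero {g : E → ℝ} (hg : ContDiff ℝ 1 g)
    (hs : HasCompactSupport g) (v : E) : ∫ y, fderiv ℝ g y v ∂ν = 0 := by
  have hd : Continuous fun y => fderiv ℝ g y v := 
    (hg.continuous_fderiv (by simp)).clm_apply continuous_const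
  -- Integration by parts against the constant 1, whose derivative vanishes.
  have h := integral_mul_fderiv_eq_neg_fderiv_mul_of_integrable (μ := ν) (f := fun _ => (1 : ℝ))
    (g := g) (v := v) (by simp) (by
      simpa using hd.integrable_of_hasCompactSupport (hs.fderiv_apply ℝ v))
    (by simpa using hg.continuous.integrable_of_hasCompactSupport hs)
    (fun x _ => by fun_prop) (fun x _ => hg.differentiable (by simp) x)
  simpa using h

theorem integral_extDeriv_eq_zero {m : ℕ} {g : E → E [⋀^Fin m]→L[ℝ] ℝ} (hg : ContDiff ℝ 1 g)
    (hs : HasCompactSupport g) (v : Fin (m + 1) → E) : ∫ y, extDeriv g y v ∂ν = 0 := by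
  have hgi : ∀ i : Fin (m + 1), ContDiff ℝ 1 fun y => g y (i.removeNth v) := fun i =>
    (ContinuousAlternatingMap.apply ℝ E ℝ (i.removeNth v)).contDiff.comp hg
  have hsi : ∀ i : Fin (m + 1), HasCompactSupport fun y => g y (i.removeNth v) := fun i =>
    hs.comp_left (g := fun a : E [⋀^Fin m]→L[ℝ] ℝ => a (i.removeNth v)) rfl
  simp only [fun y => extDeriv_apply (hg.differentiable (by simp) y) v, zsmul_eq_mul]
  rw [integral_finsetSum]
  · refine Finset.sum_eq_zero fun i _ => ?_
    rw [integral_const_mul, integral_fderiv_apply_eq_zero ν (hgi i) (hsi i), mul_zero]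
  · intro i _
    exact (Continuous.integrable_of_hasCompactSupport
      (((hgi i).continuous_fderiv (by simp)).clm_apply continuous_const)
      ((hsi i).fderiv_apply ℝ _)).const_mul _

end EuclideanStokes

/-! ### Integration in charts and Stokes' theorem on a compact manifold. -/

section CompactStokes

open MeasureTheory Module

variable {E : Type*} [NormedAddCommGroup E] [NormedSpace ℝ E]
  {M : Type*} [TopologicalSpace M] [ChartedSpace E M]

/-- The coefficient of a top degree form in a chart, with respect to a basis of the model space. -/
def coef {m : ℕ} (b : Basis (Fin m) ℝ E) (τ : RawForm E M m) (e : OpenPartialHomeomorph M E)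
    (y : E) : ℝ := inChart τ e y b

/-- The coefficient of the top degree form `τ` in the chart `e`, for the orientation of `M` given
by the nowhere vanishing form `μ`. -/
def orientedCoef {m : ℕ} (b : Basis (Fin m) ℝ E) (μ τ : RawForm E M m)
    (e : OpenPartialHomeomorph M E) (y : E) : ℝ :=
  (SignType.sign (coef b μ e y) : ℝ) * coef b τ e y

theorem coef_change {m : ℕ} (b : Basis (Fin m) ℝ E) (τ : RawForm E M m)
    {e e' : OpenPartialHomeomorph M E} (he : e ∈ IsManifold.maximalAtlas 𝓘(ℝ, E) ∞ M)
    (he' : e' ∈ IsManifold.maximalAtlas 𝓘(ℝ, E) ∞ M) {y : E} (hy : y ∈ e.target)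
    (hy' : e.symm y ∈ e'.source) :
    coef b τ e y = (fderiv ℝ (e' ∘ e.symm) y).det * coef b τ e' ((e' ∘ e.symm) y) := by
  rw [coef, inChart_change τ he he' hy hy']
  set f := inChart τ e' ((e' ∘ e.symm) y) with hf
  set L := fderiv ℝ (e' ∘ e.symm) y
  have h1 := congrArg (fun g : E [⋀^Fin m]→ₗ[ℝ] ℝ => g (L ∘ b))
    (f.toAlternatingMap.eq_smul_basis_det b)
  have h2 := b.det_comp L.toLinearMap b
  rw [b.det_self, mul_one] at h2
  refine h1.trans ?_
  rw [AlternatingMap.smul_apply, smul_eq_mul, mul_comm]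
  exact congrArg (· * f b) h2

/-- The coefficient of τ scales by the Jacobian determinant and the sign of that of μ by the
determinant's sign. Their product is the absolute value in the change of variables formula, so no
oriented atlas is needed. -/
theorem orientedCoef_change {m : ℕ} (b : Basis (Fin m) ℝ E) (μ τ : RawForm E M m)
    {e e' : OpenPartialHomeomorph M E} (he : e ∈ IsManifold.maximalAtlas 𝓘(ℝ, E) ∞ M)
    (he' : e' ∈ IsManifold.maximalAtlas 𝓘(ℝ, E) ∞ M) {y : E} (hy : y ∈ e.target)
    (hy' : e.symm y ∈ e'.source) :
    orientedCoef b μ τ e y =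
      |(fderiv ℝ (e' ∘ e.symm) y).det| * orientedCoef b μ τ e' ((e' ∘ e.symm) y) := by
  rw [orientedCoef, orientedCoef, coef_change b μ he he' hy hy', coef_change b τ he he' hy hy',
    sign_mul, ← sign_mul_self, SignType.coe_mul]
  ring

theorem orientedCoef_eq_zero {m : ℕ} (b : Basis (Fin m) ℝ E) (μ : RawForm E M m)
    {τ : RawForm E M m} {e : OpenPartialHomeomorph M E} {y : E} (h : τ (e.symm y) = 0) :
    orientedCoef b μ τ e y = 0 := by
  have h0 : coef b τ e y = 0 := by
    rw [coef, inChart_eq_zero h]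
    rfl
  rw [orientedCoef, h0, mul_zero]

theorem contDiffOn_coef {m : ℕ} (b : Basis (Fin m) ℝ E) (τ : DiffForm E M m)
    {e : OpenPartialHomeomorph M E} (he : e ∈ IsManifold.maximalAtlas 𝓘(ℝ, E) ∞ M) :
    ContDiffOn ℝ ∞ (coef b τ.1 e) e.target :=
  (ContinuousAlternatingMap.apply ℝ E ℝ b).contDiff.comp_contDiffOn (τ.2 e he)

theorem coef_ne_zero {m : ℕ} (b : Basis (Fin m) ℝ E) {μ : RawForm E M m} (hμ : ∀ x, μ x ≠ 0)
    {e : OpenPartialHomeomorph M E} (he : e ∈ IsManifold.maximalAtlas 𝓘(ℝ, E) ∞ M) {y : E}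
    (hy : y ∈ e.target) : coef b μ e y ≠ 0 := by
  have h := inChart_ne_zero he hy (hμ (e.symm y))
  have h2 : (inChart μ e y).toAlternatingMap ≠ 0 := fun h0 =>
    h (ContinuousAlternatingMap.toAlternatingMap_injective h0)
  exact (AlternatingMap.map_basis_ne_zero_iff b _).2 h2

/-- Since μ never vanishes, the orientation sign is locally constant, and it behaves as a constant
under limits and derivatives. -/
theorem eventually_sign_coef_eq {m : ℕ} (b : Basis (Fin m) ℝ E) {μ : DiffForm E M m}
    (hμ : ∀ x, μ.1 x ≠ 0) {e : OpenPartialHomeomorph M E}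
    (he : e ∈ IsManifold.maximalAtlas 𝓘(ℝ, E) ∞ M) {y : E} (hy : y ∈ e.target) :
    ∀ᶠ z in nhds y, SignType.sign (coef b μ.1 e z) = SignType.sign (coef b μ.1 e y) := by
  have h1 : ContinuousAt (coef b μ.1 e) y :=
    (contDiffOn_coef b μ he).continuousOn.continuousAt (e.open_target.mem_nhds hy)
  have h2 : ContinuousAt (fun z => SignType.sign (coef b μ.1 e z)) y :=
    (continuousAt_sign_of_ne_zero (coef_ne_zero b hμ he hy)).comp h1
  exact h2.eventually ((isOpen_discrete {_}).mem_nhds rfl)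

theorem continuousOn_orientedCoef {m : ℕ} (b : Basis (Fin m) ℝ E) {μ : DiffForm E M m}
    (hμ : ∀ x, μ.1 x ≠ 0) (τ : DiffForm E M m) {e : OpenPartialHomeomorph M E}
    (he : e ∈ IsManifold.maximalAtlas 𝓘(ℝ, E) ∞ M) :
    ContinuousOn (orientedCoef b μ.1 τ.1 e) e.target := by
  intro y hy
  have h1 : ContinuousAt (coef b τ.1 e) y :=
    (contDiffOn_coef b τ he).continuousOn.continuousAt (e.open_target.mem_nhds hy)
  refine ContinuousAt.continuousWithinAt ?_
  refine (h1.const_mul (SignType.sign (coef b μ.1 e y) : ℝ)).congr ?_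
  filter_upwards [eventually_sign_coef_eq b hμ he hy] with z hz
  rw [orientedCoef, hz]

variable [MeasurableSpace E] (ν : Measure E)

/-- The integral of the top degree form `τ` over the domain of the chart `e`, for the orientation
given by `μ`. -/
def chartIntegral {m : ℕ} (b : Basis (Fin m) ℝ E) (μ τ : RawForm E M m)
    (e : OpenPartialHomeomorph M E) : ℝ :=
  ∫ y in e.target, orientedCoef b μ τ e y ∂ν

theorem chartIntegral_sum {m : ℕ} {ι : Type*} [Fintype ι] (b : Basis (Fin m) ℝ E)
    (μ : RawForm E M m) (τ : ι → RawForm E M m) (σ : RawForm E M m) (hσ : σ = ∑ i, τ i)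
    (e : OpenPartialHomeomorph M E)
    (hτ : ∀ i, IntegrableOn (orientedCoef b μ (τ i) e) e.target ν) :
    chartIntegral ν b μ σ e = ∑ i, chartIntegral ν b μ (τ i) e := by
  have h1 : ∀ y, orientedCoef b μ σ e y = ∑ i, orientedCoef b μ (τ i) e y := fun y => by
    simp only [orientedCoef, ← Finset.mul_sum]
    congr 1
    rw [hσ]
    change ((∑ i, τ i) (e.symm y) : E [⋀^Fin m]→L[ℝ] ℝ) _ = _
    rw [Finset.sum_apply]
    exact ContinuousAlternatingMap.sum_apply _ _
  simp only [chartIntegral, h1]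
  exact integral_finsetSum _ fun i _ => hτ i

variable [BorelSpace E] [ν.IsAddHaarMeasure]

theorem integrableOn_orientedCoef {m : ℕ} (b : Basis (Fin m) ℝ E) {μ : DiffForm E M m}
    (hμ : ∀ x, μ.1 x ≠ 0) (τ : DiffForm E M m) {e : OpenPartialHomeomorph M E}
    (he : e ∈ IsManifold.maximalAtlas 𝓘(ℝ, E) ∞ M) {K : Set M} (hK : IsCompact K)
    (hKe : K ⊆ e.source) (hτ : ∀ x, x ∉ K → τ.1 x = 0) :
    IntegrableOn (orientedCoef b μ.1 τ.1 e) e.target ν := by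
  have hK' : IsCompact (e '' K) := hK.image_of_continuousOn (e.continuousOn.mono hKe)
  have hsub : e '' K ⊆ e.target := by
    rintro _ ⟨x, hx, rfl⟩
    exact e.map_source (hKe hx)
  refine IntegrableOn.of_forall_sdiff_eq_zero
    (((continuousOn_orientedCoef b hμ τ he).mono hsub).integrableOn_compact hK')
    e.open_target.measurableSet fun y hy => orientedCoef_eq_zero b μ.1 (hτ _ fun hy' => hy.2 ?_)
  exact ⟨e.symm y, hy', e.right_inv hy.1⟩

variable [FiniteDimensional ℝ E]

/-- Both integrands vanish off the overlap of the two charts, where the transition map changes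
variables. -/
theorem chartIntegral_change {m : ℕ} (b : Basis (Fin m) ℝ E) (μ τ : RawForm E M m)
    {e e' : OpenPartialHomeomorph M E} (he : e ∈ IsManifold.maximalAtlas 𝓘(ℝ, E) ∞ M)
    (he' : e' ∈ IsManifold.maximalAtlas 𝓘(ℝ, E) ∞ M)
    (h : ∀ x, x ∉ e.source → τ x = 0) (h' : ∀ x, x ∉ e'.source → τ x = 0) :
    chartIntegral ν b μ τ e = chartIntegral ν b μ τ e' := by
  set φ : OpenPartialHomeomorph E E := e.symm.trans e' with hφ
  have hsrc : ∀ y, y ∈ φ.source ↔ y ∈ e.target ∧ e.symm y ∈ e'.source := fun y => by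
    simp [hφ]
  have htgt : ∀ y, y ∈ φ.target ↔ y ∈ e'.target ∧ e'.symm y ∈ e.source := fun y => by
    simp [hφ]
  have h1 : chartIntegral ν b μ τ e = ∫ y in φ.source, orientedCoef b μ τ e y ∂ν := by
    refine setIntegral_eq_of_subset_of_forall_sdiff_eq_zero e.open_target.measurableSet
      (fun y hy => ((hsrc y).1 hy).1) fun y hy => orientedCoef_eq_zero b μ (h' _ fun hy' => ?_)
    exact hy.2 ((hsrc y).2 ⟨hy.1, hy'⟩)
  have h2 : chartIntegral ν b μ τ e' = ∫ y in φ.target, orientedCoef b μ τ e' y ∂ν := by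
    refine setIntegral_eq_of_subset_of_forall_sdiff_eq_zero e'.open_target.measurableSet
      (fun y hy => ((htgt y).1 hy).1) fun y hy => orientedCoef_eq_zero b μ (h _ fun hy' => ?_)
    exact hy.2 ((htgt y).2 ⟨hy.1, hy'⟩)
  rw [h1, h2, ← φ.image_source_eq_target,
    integral_image_eq_integral_abs_det_fderiv_smul ν φ.open_source.measurableSet
      (f' := fun y => fderiv ℝ (e' ∘ e.symm) y) (fun y hy => ?_) φ.injOn]
  · refine setIntegral_congr_fun φ.open_source.measurableSet fun y hy => ?_
    obtain ⟨hy1, hy2⟩ := (hsrc y).1 hy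
    exact orientedCoef_change b μ τ he he' hy1 hy2
  · obtain ⟨hy1, hy2⟩ := (hsrc y).1 hy
    exact ((contDiffAt_transition he he' hy1 hy2).differentiableAt
      (by simp)).hasFDerivAt.hasFDerivWithinAt

theorem chartIntegral_d_eq_zero [IsManifold 𝓘(ℝ, E) ∞ M] {m : ℕ} (b : Basis (Fin (m + 1)) ℝ E)
    {μ : DiffForm E M (m + 1)} (hμ : ∀ x, μ.1 x ≠ 0) (α : DiffForm E M m)
    {e : OpenPartialHomeomorph M E} (he : e ∈ IsManifold.maximalAtlas 𝓘(ℝ, E) ∞ M) {K : Set M}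
    (hK : IsCompact K) (hKe : K ⊆ e.source) (hα : ∀ x, x ∉ K → α.1 x = 0) :
    chartIntegral ν b μ.1 (d E M m α).1 e = 0 := by
  classical
  have hK' : IsCompact (e '' K) := hK.image_of_continuousOn (e.continuousOn.mono hKe)
  have hsub : e '' K ⊆ e.target := by
    rintro _ ⟨x, hx, rfl⟩
    exact e.map_source (hKe hx)
  -- The oriented local expression of α, extended by zero. It is C¹ on all of E because it vanishes
  -- off the compact set `e '' K`, which lies in the chart target.
  let g : E → E [⋀^Fin m]→L[ℝ] ℝ := fun y =>
    if y ∈ e.target then (SignType.sign (coef b μ.1 e y) : ℝ) • inChart α.1 e y else 0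
  have hg0 : ∀ y, y ∉ e '' K → g y = 0 := fun y hy => by
    by_cases hyt : y ∈ e.target
    · simp only [g, if_pos hyt]
      rw [inChart_eq_zero (hα _ fun h => hy ⟨_, h, e.right_inv hyt⟩), smul_zero]
    · simp only [g, if_neg hyt]
  have hgin : ∀ y ∈ e.target, g =ᶠ[nhds y]
      (SignType.sign (coef b μ.1 e y) : ℝ) • inChart α.1 e := fun y hy => by
    filter_upwards [eventually_sign_coef_eq b hμ he hy, e.open_target.mem_nhds hy] with z hz hzt
    simp only [g, if_pos hzt, hz, Pi.smul_apply]
  have hgout : ∀ y, y ∉ e.target → g =ᶠ[nhds y] fun _ => 0 := fun y hy => by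
    filter_upwards [hK'.isClosed.isOpen_compl.mem_nhds fun h => hy (hsub h)] with z hz
      using hg0 z hz
  have hgc : ContDiff ℝ 1 g := by
    rw [contDiff_iff_contDiffAt]
    intro y
    by_cases hy : y ∈ e.target
    · refine ContDiffAt.congr_of_eventuallyEq ?_ (hgin y hy)
      have h1 : ContDiffAt ℝ 1 (inChart α.1 e) y :=
        ((α.2 e he).contDiffAt (e.open_target.mem_nhds hy)).of_le (by exact_mod_cast le_top)
      exact h1.const_smul (SignType.sign (coef b μ.1 e y) : ℝ)
    · exact contDiffAt_const.congr_of_eventuallyEq (hgout y hy)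
  rw [← integral_extDeriv_eq_zero ν hgc (HasCompactSupport.intro hK' hg0) b, chartIntegral,
    ← setIntegral_eq_integral_of_forall_compl_eq_zero (s := e.target)
      (f := fun y => extDeriv g y b)]
  · refine setIntegral_congr_fun e.open_target.measurableSet fun y hy => ?_
    have h1 : extDeriv g y = (SignType.sign (coef b μ.1 e y) : ℝ) •
        extDeriv (inChart α.1 e) y := by
      rw [(hgin y hy).extDeriv_eq, extDeriv_smul]
    simp only [h1, orientedCoef]
    rw [← inChart_rawD α.2 he hy]
    rfl
  · intro y hy
    rw [(hgout y hy).extDeriv_eq, extDeriv]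
    simp [ContinuousAlternatingMap.alternatizeUncurryFin_apply]

variable (E) in
/-- **Stokes' theorem** for compact manifolds, in the form that no volume form is exact. -/
theorem exists_d_apply_eq_zero [IsManifold 𝓘(ℝ, E) ∞ M] [T2Space M] [CompactSpace M] [Nonempty M]
    {m : ℕ} (hm : finrank ℝ E = m + 1) (β : DiffForm E M m) : ∃ x, (d E M m β).1 x = 0 := by
  -- The form dβ, assumed nowhere zero, serves as the orientation: its own integral must be
  -- positive, yet it will be computed to be 0.
  by_contra! hμ
  let ν : Measure E := Measure.addHaar
  let b : Basis (Fin (m + 1)) ℝ E := finBasisOfFinrankEq ℝ E hm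
  set μ := d E M m β with hμdef
  obtain ⟨t, -, ht⟩ := isCompact_univ.elim_nhds_subcover (fun x : M => (chartAt E x).source)
    fun x _ => (chartAt E x).open_source.mem_nhds (mem_chart_source E x)
  obtain ⟨ρ, hρ⟩ := SmoothPartitionOfUnity.exists_isSubordinate (ι := t) 𝓘(ℝ, E)
    (isClosed_univ (X := M)) (fun i => (chartAt E (i : M)).source)
    (fun i => (chartAt E (i : M)).open_source) (by
      intro x hx
      obtain ⟨z, hz, hxz⟩ := Set.mem_iUnion₂.1 (ht hx)
      exact Set.mem_iUnion.2 ⟨⟨z, hz⟩, hxz⟩)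
  have hρsum : ∀ x, ∑ i, ρ i x = 1 := fun x => by
    rw [← finsum_eq_sum_of_fintype]
    exact ρ.sum_eq_one (Set.mem_univ x)
  let e : t → OpenPartialHomeomorph M E := fun i => chartAt E (i : M)
  have he : ∀ i, e i ∈ IsManifold.maximalAtlas 𝓘(ℝ, E) ∞ M := fun i =>
    IsManifold.chart_mem_maximalAtlas _
  let K : t → Set M := fun i => tsupport (ρ i)
  have hK : ∀ i, IsCompact (K i) := fun i => (isClosed_tsupport _).isCompact
  have hKe : ∀ i, K i ⊆ (e i).source := hρ
  have hρ0 : ∀ i x, x ∉ K i → ρ i x = 0 := fun i x hx => image_eq_zero_of_notMem_tsupport hx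
  let β' : t → DiffForm E M m := fun j => smulForm (ρ j) (ρ j).contMDiff β
  let τ : t → DiffForm E M (m + 1) := fun j => d E M m (β' j)
  have hβ'0 : ∀ j x, x ∉ K j → (β' j).1 x = 0 := fun j x hx => by
    rw [smulForm_apply, hρ0 j x hx, zero_smul]
  have hτ0 : ∀ j x, x ∉ K j → (τ j).1 x = 0 := fun j x hx => by
    refine rawD_eq_zero_of_eventually ?_
    filter_upwards [(isClosed_tsupport (ρ j)).isOpen_compl.mem_nhds hx] with z hz
      using hβ'0 j z hz
  have hμτ : μ = ∑ j, τ j := by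
    have : β = ∑ j, β' j := by
      apply Subtype.ext
      funext x
      rw [Submodule.coe_sum, Finset.sum_apply]
      simp only [β', smulForm_apply]
      rw [← Finset.sum_smul, hρsum, one_smul]
    rw [hμdef, ← map_sum, ← this]
  -- The pieces ρᵢ d(ρⱼβ) vanish outside the supports of both ρᵢ and ρⱼ, so each may be integrated
  -- in chart i or in chart j.
  let θ : t → t → DiffForm E M (m + 1) := fun i j => smulForm (ρ i) (ρ i).contMDiff (τ j)
  have hθi : ∀ i j x, x ∉ K i → (θ i j).1 x = 0 := fun i j x hx => by
    rw [smulForm_apply, hρ0 i x hx, zero_smul]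
  have hθj : ∀ i j x, x ∉ K j → (θ i j).1 x = 0 := fun i j x hx => by
    rw [smulForm_apply, hτ0 j x hx, smul_zero]
  let σ : t → DiffForm E M (m + 1) := fun i => smulForm (ρ i) (ρ i).contMDiff μ
  have h1 : ∀ i, chartIntegral ν b μ.1 (σ i).1 (e i) =
      ∑ j, chartIntegral ν b μ.1 (θ i j).1 (e i) := fun i => by
    refine chartIntegral_sum ν b μ.1 (fun j => (θ i j).1) _ ?_ (e i) fun j =>
      integrableOn_orientedCoef ν b hμ (θ i j) (he i) (hK i) (hKe i) (hθi i j)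
    funext x
    rw [Finset.sum_apply]
    simp only [σ, θ, smulForm_apply]
    rw [hμτ, ← Finset.smul_sum, Submodule.coe_sum, Finset.sum_apply]
  have h2 : ∀ j, ∑ i, chartIntegral ν b μ.1 (θ i j).1 (e j) = 0 := fun j => by
    rw [← chartIntegral_d_eq_zero ν b hμ (β' j) (he j) (hK j) (hKe j) (hβ'0 j)]
    refine (chartIntegral_sum ν b μ.1 (fun i => (θ i j).1) _ ?_ (e j) fun i =>
      integrableOn_orientedCoef ν b hμ (θ i j) (he j) (hK j) (hKe j) (hθj i j)).symm
    funext x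
    rw [Finset.sum_apply]
    simp only [θ, smulForm_apply]
    rw [← Finset.sum_smul, hρsum, one_smul]
  -- Exchange the sums and move the (i, j) piece to chart j. Summing over i restores d(ρⱼβ), whose
  -- integral is 0.
  have h3 : ∑ i, chartIntegral ν b μ.1 (σ i).1 (e i) = 0 := by
    simp only [h1]
    rw [Finset.sum_comm]
    refine Finset.sum_eq_zero fun j _ => Eq.trans (Finset.sum_congr rfl fun i _ => ?_) (h2 j)
    exact chartIntegral_change ν b μ.1 (θ i j).1 (he i) (he j)
      (fun x hx => hθi i j x fun h => hx (hKe i h)) (fun x hx => hθj i j x fun h => hx (hKe j h))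
  have h4 : ∀ i y, orientedCoef b μ.1 (σ i).1 (e i) y =
      ρ i ((e i).symm y) * |coef b μ.1 (e i) y| := fun i y => by
    rw [orientedCoef, ← sign_mul_self]
    have : coef b (σ i).1 (e i) y = ρ i ((e i).symm y) * coef b μ.1 (e i) y := rfl
    rw [this]
    ring
  have h5 : ∀ i y, 0 ≤ orientedCoef b μ.1 (σ i).1 (e i) y := fun i y => by
    rw [h4]
    exact mul_nonneg (ρ.nonneg i _) (abs_nonneg _)
  obtain ⟨x⟩ := ‹Nonempty M›
  obtain ⟨i, hi⟩ : ∃ i, ρ i x ≠ 0 := by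
    by_contra! hall
    have := hρsum x
    simp [hall] at this
  have h6 : chartIntegral ν b μ.1 (σ i).1 (e i) = 0 :=
    (Finset.sum_eq_zero_iff_of_nonneg fun i _ => integral_nonneg (h5 i)).1 h3 i (Finset.mem_univ i)
  have hint := integrableOn_orientedCoef ν b hμ (σ i) (he i) (hK i) (hKe i) fun x hx => by
    rw [smulForm_apply, hρ0 i x hx, zero_smul]
  have h7 := setIntegral_pos_iff_support_of_nonneg_ae (Filter.Eventually.of_forall (h5 i)) hint
  refine (h7.2 ?_).ne' h6
  have hopen : IsOpen ((e i).target ∩ (e i).symm ⁻¹' {z | ρ i z ≠ 0}) :=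
    (e i).isOpen_inter_preimage_symm (isOpen_ne_fun (ρ i).contMDiff.continuous continuous_const)
  have hxs : x ∈ (e i).source := by
    by_contra hx
    exact hi (hρ0 i x fun h => hx (hKe i h))
  refine (hopen.measure_pos ν ⟨e i x, (e i).map_source hxs, ?_⟩).trans_le
    (measure_mono fun y hy => ⟨?_, hy.1⟩)
  · simpa [(e i).left_inv hxs] using hi
  · rw [Function.mem_support, h4]
    exact mul_ne_zero hy.2 (abs_ne_zero.2 (coef_ne_zero b hμ (he i) hy.1))

end CompactStokes

/-! ### Functions on a compact manifold have critical points. -/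

section ZeroForms

variable {E : Type*} [NormedAddCommGroup E] [NormedSpace ℝ E]
  {M : Type*} [TopologicalSpace M] [ChartedSpace E M]

theorem inChart_zeroForm_apply (f : RawForm E M 0) (e : OpenPartialHomeomorph M E) (y : E)
    (v : Fin 0 → E) : inChart f e y v = f (e.symm y) (fun i => i.elim0) := by
  change (f (e.symm y) : E [⋀^Fin 0]→L[ℝ] ℝ) _ = _
  exact congrArg _ (funext fun i => i.elim0)

variable [IsManifold 𝓘(ℝ, E) ∞ M]

theorem continuous_zeroForm (f : DiffForm E M 0) :
    Continuous fun x : M => f.1 x (fun i => i.elim0) := by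
  rw [continuous_iff_continuousAt]
  intro x
  have h1 := (differentiableAt_inChart f.2 x).continuousAt
  have h2 := ((ContinuousAlternatingMap.apply ℝ E ℝ
    (fun i : Fin 0 => i.elim0)).continuous.continuousAt.comp h1).comp
      ((chartAt E x).continuousAt (mem_chart_source E x))
  refine h2.congr ?_
  filter_upwards [(chartAt E x).open_source.mem_nhds (mem_chart_source E x)] with z hz
  refine (inChart_zeroForm_apply f.1 (chartAt E x) (chartAt E x z) _).trans ?_
  rw [(chartAt E x).left_inv hz]

theorem exists_d_zeroForm_apply_eq_zero [CompactSpace M] [Nonempty M] (f : DiffForm E M 0) :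
    ∃ x, (d E M 0 f).1 x = 0 := by
  obtain ⟨x, -, hx⟩ := isCompact_univ.exists_isMaxOn (Set.univ_nonempty (α := M))
    (continuous_zeroForm f).continuousOn
  refine ⟨x, ?_⟩
  have h0 : extDeriv (inChart f.1 (chartAt E x)) (chartAt E x x) = 0 := by
    ext v
    rw [extDeriv_apply (differentiableAt_inChart f.2 x)]
    refine Finset.sum_eq_zero fun i _ => ?_
    have hmax : IsLocalMax (fun y => inChart f.1 (chartAt E x) y (i.removeNth v))
        (chartAt E x x) := by
      -- The inequality holds even for y outside the chart target: `e.symm y` is still a point of M,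
      -- and x is a global maximum.
      refine Filter.Eventually.of_forall fun y => ?_
      simp only [inChart_zeroForm_apply]
      rw [(chartAt E x).left_inv (mem_chart_source E x)]
      exact hx (Set.mem_univ _)
    rw [hmax.fderiv_eq_zero]
    simp
  ext v
  exact congrArg (fun f : E [⋀^Fin 1]→L[ℝ] ℝ =>
    f fun i => mfderiv 𝓘(ℝ, E) 𝓘(ℝ, E) (chartAt E x) x (v i)) h0

end ZeroForms

/-! ### From non-exactness over the sphere to independent cohomology classes. -/

section LinearIndependence

variable {E : Type*} [NormedAddCommGroup E] [NormedSpace ℝ E]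
  {M : Type*} [TopologicalSpace M] [ChartedSpace E M] [IsManifold 𝓘(ℝ, E) ∞ M]

theorem linearIndependent_deRhamClass {k p : ℕ} (α : Fin (p + 1) → DiffForm E M (k + 1))
    (hα : ∀ i, α i ∈ closedForms E M (k + 1))
    (h : ∀ c ∈ Metric.sphere (0 : EuclideanSpace ℝ (Fin (p + 1))) 1,
      ∀ β, d E M k β ≠ ∑ i, c i • α i) :
    LinearIndependent ℝ fun i => deRhamClass (α i) (hα i) := by
  rw [Fintype.linearIndependent_iff]
  intro c hc
  by_contra! hne
  obtain ⟨i₀, hi₀⟩ := hne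
  let c' : EuclideanSpace ℝ (Fin (p + 1)) := WithLp.toLp 2 c
  have hc' : c' ≠ 0 := fun h0 => hi₀ (congrArg (fun w : EuclideanSpace ℝ (Fin (p + 1)) => w i₀) h0)
  have hmem : (∑ i, c i • (⟨α i, hα i⟩ : closedForms E M (k + 1))) ∈
      (exactForms E M (k + 1)).submoduleOf (closedForms E M (k + 1)) := by
    rw [← Submodule.Quotient.mk_eq_zero, ← hc, ← Submodule.mkQ_apply, map_sum]
    simp only [map_smul]
    rfl
  obtain ⟨β, hβ⟩ := Submodule.mem_comap.1 hmem
  have hβ' : d E M k β = ∑ i, c i • α i := by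
    rw [hβ]
    simp
  -- Normalising the relation brings its coefficients onto the unit sphere; the primitive scales
  -- along.
  refine h (‖c'‖⁻¹ • c') ?_ (‖c'‖⁻¹ • β) ?_
  · rw [mem_sphere_zero_iff_norm, norm_smul, norm_inv, norm_norm,
      inv_mul_cancel₀ (norm_ne_zero_iff.2 hc')]
  · rw [map_smul, hβ', Finset.smul_sum]
    exact Finset.sum_congr rfl fun i _ => smul_smul _ _ _

theorem card_le_betti {k p : ℕ} {α : Fin (p + 1) → DeRham E M k} (h : LinearIndependent ℝ α) :
    ((p + 1 : ℕ) : Cardinal) ≤ betti E M k := by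
  have := h.cardinal_lift_le_rank
  simpa [betti] using this

end LinearIndependence

/-! ### Non-exactness of cosymplectic forms and the dimension constraint. -/

section CosymplecticForms

theorem zero_wedge {V : Type*} [AddCommGroup V] [Module ℝ V] {k l : ℕ} (b : V [⋀^Fin l]→ₗ[ℝ] ℝ) :
    wedge (0 : V [⋀^Fin k]→ₗ[ℝ] ℝ) b = 0 := LinearMap.map_zero₂ (wedgeLin k l) b

variable {n : ℕ} {M : Type*} [TopologicalSpace M]
  [ChartedSpace (EuclideanSpace ℝ (Fin (2 * n + 1))) M]

theorem IsAlmostCosymplectic.apply_ne_zero {η : DiffForm (EuclideanSpace ℝ (Fin (2 * n + 1))) M 1}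
    {Ω : DiffForm (EuclideanSpace ℝ (Fin (2 * n + 1))) M 2} (h : IsAlmostCosymplectic η Ω)
    (x : M) : η.1 x ≠ 0 := fun h0 => h x <| by
  rw [h0]
  exact zero_wedge _

theorem IsAlmostCosymplectic.eta_ne_d [IsManifold (𝓡 (2 * n + 1)) ∞ M] [CompactSpace M]
    [Nonempty M] {η : DiffForm (EuclideanSpace ℝ (Fin (2 * n + 1))) M 1}
    {Ω : DiffForm (EuclideanSpace ℝ (Fin (2 * n + 1))) M 2} (h : IsAlmostCosymplectic η Ω)
    (f : DiffForm (EuclideanSpace ℝ (Fin (2 * n + 1))) M 0) : d _ M 0 f ≠ η := by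
  rintro rfl
  obtain ⟨x, hx⟩ := exists_d_zeroForm_apply_eq_zero f
  exact h.apply_ne_zero x hx

theorem IsAlmostCosymplectic.omega_ne_d [IsManifold (𝓡 (2 * n + 1)) ∞ M] [T2Space M]
    [CompactSpace M] [Nonempty M] {η : DiffForm (EuclideanSpace ℝ (Fin (2 * n + 1))) M 1}
    {Ω : DiffForm (EuclideanSpace ℝ (Fin (2 * n + 1))) M 2} (h : IsAlmostCosymplectic η Ω)
    (hn : 0 < n) (hη : d _ M 1 η = 0) (hΩ : d _ M 2 Ω = 0)
    (α : DiffForm (EuclideanSpace ℝ (Fin (2 * n + 1))) M 1) : d _ M 1 α ≠ Ω := by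
  intro hα
  obtain ⟨m, rfl⟩ : ∃ m, n = m + 1 := ⟨n - 1, by omega⟩
  -- With n = m + 1, the primitive η ∧ Ωᵐ ∧ α has degree 1 + (2m + 1) = 2n. Its differential is -η ∧
  -- Ωⁿ: passing η gives the sign, and passing the even form Ωᵐ gives none.
  obtain ⟨x, hx⟩ := exists_d_apply_eq_zero (EuclideanSpace ℝ (Fin (2 * (m + 1) + 1)))
    (m := 1 + (2 * m + 1)) (by rw [finrank_euclideanSpace_fin]; omega)
    (wedgeForm η (wedgeForm (powForm Ω m) α))
  rw [d_wedgeForm_of_closed hη, d_wedgeForm_of_closed (d_powForm hΩ m), hα,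
    Even.neg_one_pow (even_two_mul m), one_smul, pow_one, neg_one_smul] at hx
  have hx' : (wedgeForm η (wedgeForm (powForm Ω m) Ω)).1 x = 0 := neg_eq_zero.1 hx
  refine h x ?_
  rw [← powForm_apply]
  exact congrArg ContinuousAlternatingMap.toAlternatingMap hx'

theorem IsAlmostCosymplecticSphere.dim_pos {p : ℕ} [Nonempty M]
    {η : Fin (p + 1) → DiffForm (EuclideanSpace ℝ (Fin (2 * n + 1))) M 1}
    {Ω : Fin (p + 1) → DiffForm (EuclideanSpace ℝ (Fin (2 * n + 1))) M 2}
    (h : IsAlmostCosymplecticSphere η Ω) (hp : 0 < p) : 0 < n := by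
  by_contra hn
  obtain rfl : n = 0 := by omega
  obtain ⟨x⟩ := ‹Nonempty M›
  let b := (EuclideanSpace.basisFun (Fin (2 * 0 + 1)) ℝ).toBasis
  let a : Fin (p + 1) → EuclideanSpace ℝ (Fin (2 * 0 + 1)) [⋀^Fin (2 * 0 + 1)]→L[ℝ] ℝ :=
    fun i => (η i).1 x
  -- In dimension 1 a covector is determined by one real number, and p + 1 ≥ 2 real numbers are
  -- linearly dependent.
  have hnot : ¬ LinearIndependent ℝ fun i => a i b := fun hli => by
    have := hli.fintype_card_le_finrank
    simp at this
    omega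
  obtain ⟨c, hc, i₀, hi₀⟩ := Fintype.not_linearIndependent_iff.1 hnot
  let c' : EuclideanSpace ℝ (Fin (p + 1)) := WithLp.toLp 2 c
  have hc' : c' ≠ 0 := fun h0 => hi₀ (congrArg (fun w : EuclideanSpace ℝ (Fin (p + 1)) => w i₀) h0)
  refine (h.sphere (‖c'‖⁻¹ • c') ?_).apply_ne_zero x ?_
  · rw [mem_sphere_zero_iff_norm, norm_smul, norm_inv, norm_norm,
      inv_mul_cancel₀ (norm_ne_zero_iff.2 hc')]
  · have h0 : ∑ i, c i • a i = 0 := by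
      apply ContinuousAlternatingMap.toAlternatingMap_injective
      refine (AlternatingMap.map_basis_eq_zero_iff b _).1 ?_
      exact (ContinuousAlternatingMap.sum_apply _ _).trans hc
    have h1 : (∑ i, (‖c'‖⁻¹ • c') i • η i).1 x = ‖c'‖⁻¹ • ∑ i, c i • a i := by
      rw [Submodule.coe_sum, Finset.sum_apply, Finset.smul_sum]
      exact Finset.sum_congr rfl fun i _ => mul_smul ‖c'‖⁻¹ (c i) (a i)
    rw [h1, h0, smul_zero]
    rfl

end CosymplecticForms

end CosymplecticSphere

end

theorem mainTheorem4 {n p : ℕ} {M : Type*} [TopologicalSpace M]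
    [ChartedSpace (EuclideanSpace ℝ (Fin (2 * n + 1))) M] [IsManifold (𝓡 (2 * n + 1)) ∞ M]
    [T2Space M] [CompactSpace M] [Nonempty M]
    (η : Fin (p + 1) → CosymplecticSphere.DiffForm (EuclideanSpace ℝ (Fin (2 * n + 1))) M 1)
    (Ω : Fin (p + 1) → CosymplecticSphere.DiffForm (EuclideanSpace ℝ (Fin (2 * n + 1))) M 2)
    (h : CosymplecticSphere.IsCosymplecticSphere η Ω) :
    ((∀ i, CosymplecticSphere.deRhamClass (η i) (h.closed_eta i) ≠ 0) ∧
      LinearIndependent ℝ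
        (fun i => CosymplecticSphere.deRhamClass (η i) (h.closed_eta i)) ∧
      ((p + 1 : ℕ) : Cardinal) ≤
        CosymplecticSphere.betti (EuclideanSpace ℝ (Fin (2 * n + 1))) M 1) ∧
    (0 < n ∨ 0 < p →
      (∀ i, CosymplecticSphere.deRhamClass (Ω i) (h.closed_omega i) ≠ 0) ∧
      LinearIndependent ℝ
        (fun i => CosymplecticSphere.deRhamClass (Ω i) (h.closed_omega i)) ∧
      ((p + 1 : ℕ) : Cardinal) ≤
        CosymplecticSphere.betti (EuclideanSpace ℝ (Fin (2 * n + 1))) M 2) := by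
  have hη := CosymplecticSphere.linearIndependent_deRhamClass η h.closed_eta
    fun c hc f => (h.sphere c hc).eta_ne_d f
  refine ⟨⟨fun i => hη.ne_zero i, hη, CosymplecticSphere.card_le_betti hη⟩, fun hnp => ?_⟩
  -- Since p > 0 already forces n > 0, the only case excluded is n = p = 0.
  have hn : 0 < n := hnp.elim id h.dim_pos
  have hΩ := CosymplecticSphere.linearIndependent_deRhamClass Ω h.closed_omega
    fun c hc α => (h.sphere c hc).omega_ne_d hn
      (Submodule.sum_smul_mem (CosymplecticSphere.closedForms _ M 1) c fun i _ => h.closed_eta i)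
      (Submodule.sum_smul_mem (CosymplecticSphere.closedForms _ M 2) c fun i _ =>
        h.closed_omega i) α
  exact ⟨fun i => hΩ.ne_zero i, hΩ, CosymplecticSphere.card_le_betti hΩ⟩
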